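/- Setting. Let $b_1,\dots,b_n\in\mathbb Z^m$ ($n\ge1$) be linearly independent, $B=(b_1,\dots,b_n)$, $t\in\mathbb Q^m$, $\gamma\ge 1$. For a basis $B$ write $L(B)$ for its lattice, $\lambda_1(B)$ for the length of a shortest non-zero vector of $L(B)$, and $u_{\perp v}=u-u|_v$, $u|_v=\frac{\langle u,v\rangle}{\langle v,v\rangle}v$. Rational numbers are represented by sign, numerator and denominator in binary. The algorithm $\mathrm{CVP}(B,t)$ is the following. If $n=1$, return a multiple $a b_1$, $a\in\mathbb Z$, closest to $t$. If $n\ge2$: (1) $z_1\leftarrow$ answer of a $\frac1{2\gamma}$-BDD solver on $(B,t)$ (if $\mathrm{dist}(t,L(B))\le\frac{1}{2\gamma}\lambda_1(B)$, it is a lattice vector closest to $t$; otherwise it is arbitrary); (2) $v\leftarrow$ answer of a $\gamma$-SVP oracle on $B$: a vector $v\in L(B)$ that is not a non-trivial integer multiple of a lattice vector, with $0<\|v\|\le\gamma\lambda_1(B)$; (3) find $\tilde b_2,\dots,\tilde b_n$ with $L(v,\tilde b_2,\dots,\tilde b_n)=L(B)$, and LLL-reduce the basis $v,\tilde b_2,\dots,\tilde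 b_n$ while keeping $v$ fixed in the first place; this gives a size-reduced basis $v,b_2,\dots,b_n$ of $L(B)$ for which $(b_2)_{\perp v},\dots,(b_n)_{\perp v}$ is LLL-reduced (with factor $3/4$); (4) $z_2'\leftarrow\mathrm{CVP}\big(((b_2)_{\perp v},\dots,(b_n)_{\perp v}),\,t_{\perp v}\big)$; find integers $a_2,\dots,a_n$ with $z_2'=\sum_{i\ge2} a_i (b_i)_{\perp v}$ and $a_1\in\mathbb Z$ such that $z_2=a_1v+\sum_{i\ge2} a_ib_i$ is closest to $t$; (5) return the element of $\{z_1,z_2\}$ that is closest to $t$. The oracle's answers are arbitrary admissible ones. The BDD solver, the basis completion and LLL are any procedures as described for which there is a polynomial $P$ such that every vector that the BDD solver or the basis completion outputs, and every vector that one of the three handles internally, has at most $P(s)$ bits, where $s$ is the bit size of the input of the call (plus $\lceil\log_2\gamma\rceil$ for the BDD solver); so it is for polynomial time procedures. Let $M=\max\{n,\log_2\gamma,\log_2\max_i\|b_i\|\}$; this is $\max\{n,\log_2\max_i\|b_i\|\}$ if $\gamma\le2^n$. Claim. For every polynomial $P$ there is a polynomial $Q$, depending only on $P$, such that for all $m,n,\gamma,B,t$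 as above and every complete run of the algorithm on $(B,t)$: (a) Let $v_1,\dots,v_n$ be the vectors $v$ of the successive levels of the recursion (on the last level, of rank one, $v_n$ is the only basis vector). There is a basis $x_1,\dots,x_n$ of $L(B)$ whose Gram–Schmidt orthogonalization (without normalization) is $v_1,\dots,v_n$, and each coordinate of the vectors $x_i$ and $v_i$ has at most $Q(M)$ bits. (b) On every level, each coordinate of the vectors $v$, $b_i$, $b_i|_v$ and $(b_i)_{\perp v}$ has at most $Q(M)$ bits. (c) Every vector generated in the run has in total at most $Q(\max\{M,\mathrm{size}(t)\})$ bits, where $\mathrm{size}(t)$ is the bit size of $t$ (which is at least $m$). This covers the vectors of (b), $z_1$, $\tilde b_i$, $t|_v$, $t_{\perp v}$, $(a_1,\dots,a_n)$, $z_2$, the returned vectors of all levels, and the internal vectors of the three subroutines. -/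

import Mathlib

/-!
Algorithm `CVP(B, t)`, which reduces approximate `CVP` to a `γ`-approximate `SVP` oracle:
lattices over `ℚ`, bit sizes, the contracts of the subroutines, and complete runs.
-/

namespace CVPReduction

noncomputable section

/-- Vectors with `m` rational coordinates. -/
abbrev Vec (m : ℕ) : Type := Fin m → ℚ

/-- A rational vector as a point of Euclidean space `ℝ ^ m`. -/
def toE {m : ℕ} (v : Vec m) : EuclideanSpace ℝ (Fin m) :=
  WithLp.toLp 2 (fun i => (v i : ℝ))

/-- Euclidean length. -/
def vnorm {m : ℕ} (v : Vec m) : ℝ := ‖toE v‖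

/-- An integer vector read as a rational one. -/
def ofInt {m : ℕ} (v : Fin m → ℤ) : Vec m := fun i => (v i : ℚ)

/-- The component `u|_v = (⟨u, v⟩ / ⟨v, v⟩) v` of `u` in the direction of `v`. -/
def comp {m : ℕ} (v u : Vec m) : Vec m := ((u ⬝ᵥ v) / (v ⬝ᵥ v)) • v

/-- The component `u_{⊥ v} = u - u|_v` of `u` orthogonal to `v`. -/
def perp {m : ℕ} (v u : Vec m) : Vec m := u - comp v u

/-! ### Bit sizes -/

/-- Bits of a rational number: a sign and the binary expansions of the numerator and of the
denominator of the reduced fraction. -/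
def ratBits (q : ℚ) : ℕ := 1 + Nat.size q.num.natAbs + Nat.size q.den

/-- Bits of a vector, given by the list of its coordinates. -/
def listBits (l : List ℚ) : ℕ := (l.map ratBits).sum

/-- Bits of a vector of `ℚ ^ m`. -/
def vecBits {m : ℕ} (v : Vec m) : ℕ := listBits (List.ofFn v)

/-- Bits of a finite family of vectors. -/
def famBits {n m : ℕ} (B : Fin n → Vec m) : ℕ := ∑ i, vecBits (B i)

/-! ### Lattices -/

/-- The lattice `L(B)`: all integer combinations of the vectors of `B`. -/
def lattice {n m : ℕ} (B : Fin n → Vec m) : Submodule ℤ (Vec m) :=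
  Submodule.span ℤ (Set.range B)

/-- The length `λ₁` of a shortest non-zero lattice vector. -/
def lambda1 {n m : ℕ} (B : Fin n → Vec m) : ℝ :=
  sInf {r : ℝ | ∃ w ∈ lattice B, w ≠ 0 ∧ vnorm w = r}

/-- The distance of `t` to the lattice. -/
def latticeDist {n m : ℕ} (t : Vec m) (B : Fin n → Vec m) : ℝ :=
  sInf {r : ℝ | ∃ w ∈ lattice B, vnorm (w - t) = r}

/-- `v` is a lattice vector which is not a non-trivial multiple of a lattice vector. -/
def IsElementary {n m : ℕ} (B : Fin n → Vec m) (v : Vec m) : Prop :=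
  v ∈ lattice B ∧ ∀ w ∈ lattice B, ∀ k : ℤ, v = k • w → k = 1 ∨ k = -1

/-- `v` is an admissible answer of a `γ`-`SVP` oracle on the basis `B`. -/
def IsSVPAnswer {n m : ℕ} (γ : ℝ) (B : Fin n → Vec m) (v : Vec m) : Prop :=
  IsElementary B v ∧ 0 < vnorm v ∧ vnorm v ≤ γ * lambda1 B

/-- `z` is an admissible answer of a `δ`-`BDD` solver on `(B, t)`. As for every promise problem,
nothing is asked when the promise `dist(t, L(B)) ≤ δ λ₁(B)` fails. -/
def IsBDDAnswer {n m : ℕ} (δ : ℝ) (B : Fin n → Vec m) (t z : Vec m) : Prop :=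
  latticeDist t B ≤ δ * lambda1 B → z ∈ lattice B ∧ vnorm (z - t) = latticeDist t B

/-! ### LLL-reduced bases -/

/-- The Gram–Schmidt vectors of a family of rational vectors. -/
def gsVec {n m : ℕ} (c : Fin n → Vec m) (i : Fin n) : EuclideanSpace ℝ (Fin m) :=
  InnerProductSpace.gramSchmidt ℝ (fun j => toE (c j)) i

/-- The Gram–Schmidt coefficients `μ i j`. -/
def gsCoeff {n m : ℕ} (c : Fin n → Vec m) (i j : Fin n) : ℝ :=
  inner ℝ (toE (c i)) (gsVec c j) / ‖gsVec c j‖ ^ 2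

/-- The family `v, b 0, b 1, …` is LLL-reduced, with factor `3/4`, relative to its fixed first
vector `v`: it is size-reduced, and Lovász' condition holds for all pairs of consecutive vectors
that do not involve `v`, which are the ones that LLL may swap. In particular the projections
`(b i)_{⊥ v}` form an LLL-reduced basis in the usual sense. -/
def IsLLLReducedRel {k m : ℕ} (v : Vec m) (b : Fin k → Vec m) : Prop :=
  let c : Fin (k + 1) → Vec m := Fin.cons v b
  (∀ i j : Fin (k + 1), j < i → |gsCoeff c i j| ≤ 1 / 2) ∧
  ∀ i j : Fin (k + 1), 1 ≤ j.val → i.val = j.val + 1 →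
    (3 / 4 - gsCoeff c i j ^ 2) * ‖gsVec c j‖ ^ 2 ≤ ‖gsVec c i‖ ^ 2

/-! ### Runs of the algorithm -/

/-- What one level with `n = k + 2 ≥ 2` basis vectors does before its recursive call. Every answer
of the `SVP` oracle is an arbitrary admissible one. The polynomial `P` bounds, in terms of the
size of their inputs, the vectors `z₁` and `bt` and those handled internally (lists `wBDD`, `wFB`,
`wLLL`, of vectors of any dimension, such as the queries of the `BDD` solver to the oracle and the
answers) by the three polynomial time subroutines. Apart from that, the subroutines are arbitrary: their
calls only have to meet their contracts. No bound is imposed on the oracle's answer `v` nor on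
the output `b` of LLL. -/
structure Descent (P : Polynomial ℕ) (γ : ℝ) {m k : ℕ} (B : Fin (k + 2) → Vec m) (t : Vec m) where
  /-- the answer of the `BDD` solver -/
  z₁ : Vec m
  /-- the answer of the `SVP` oracle -/
  v : Vec m
  /-- the completion of `v` to a basis, returned by `FB` -/
  bt : Fin (k + 1) → Vec m
  /-- the completion after LLL -/
  b : Fin (k + 1) → Vec m
  wBDD : List (List ℚ)
  wFB : List (List ℚ)
  wLLL : List (List ℚ)
  bdd : IsBDDAnswer (1 / (2 * γ)) B t z₁
  bdd_size : ∀ w ∈ List.ofFn z₁ :: wBDD,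
    listBits w ≤ P.eval (famBits B + vecBits t + ⌈Real.logb 2 γ⌉₊)
  oracle : IsSVPAnswer γ B v
  fb : lattice (Fin.cons v bt : Fin (k + 2) → Vec m) = lattice B
  fb_size : ∀ w ∈ List.ofFn (fun i => List.ofFn (bt i)) ++ wFB,
    listBits w ≤ P.eval (famBits B + vecBits v)
  /-- LLL reduces the basis `v, bt` of `L(B)`, with `v` kept in the first place -/
  lll_lattice : lattice (Fin.cons v b : Fin (k + 2) → Vec m) =
    lattice (Fin.cons v bt : Fin (k + 2) → Vec m)
  lll_reduced : IsLLLReducedRel v b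
  lll_size : ∀ w ∈ wLLL, listBits w ≤ P.eval (vecBits v + famBits bt)

/-- The basis of the recursive call. -/
def Descent.projBasis {P : Polynomial ℕ} {γ : ℝ} {m k : ℕ} {B : Fin (k + 2) → Vec m} {t : Vec m}
    (D : Descent P γ B t) : Fin (k + 1) → Vec m := fun i => perp D.v (D.b i)

/-- The target of the recursive call. -/
def Descent.projTarget {P : Polynomial ℕ} {γ : ℝ} {m k : ℕ} {B : Fin (k + 2) → Vec m} {t : Vec m}
    (D : Descent P γ B t) : Vec m := perp D.v t

/-- What a level does once its recursive call has returned `z₂'`; it returns `z`. -/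
structure Ascent {P : Polynomial ℕ} {γ : ℝ} {m k : ℕ} {B : Fin (k + 2) → Vec m} {t : Vec m}
    (D : Descent P γ B t) (z₂' z : Vec m) where
  /-- the coefficients of `z₂'` in the projected basis -/
  a : Fin (k + 1) → ℤ
  /-- the best coefficient of `v` -/
  a₁ : ℤ
  /-- the lifted vector -/
  z₂ : Vec m
  coeff : z₂' = ∑ i, a i • D.projBasis i
  lift : z₂ = a₁ • D.v + ∑ i, a i • D.b i
  nearest : ∀ a' : ℤ, vnorm (z₂ - t) ≤ vnorm (a' • D.v + ∑ i, a i • D.b i - t)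
  /-- the element of `{z₁, z₂}` that is closest to `t` is returned -/
  ret : (z = D.z₁ ∧ vnorm (D.z₁ - t) ≤ vnorm (z₂ - t)) ∨
    (z = z₂ ∧ vnorm (z₂ - t) ≤ vnorm (D.z₁ - t))

/-- `CVPRun P γ B t z`: the complete runs of `CVP(B, t)` with output `z`. -/
inductive CVPRun (P : Polynomial ℕ) (γ : ℝ) {m : ℕ} :
    {n : ℕ} → (Fin n → Vec m) → Vec m → Vec m → Type
  /-- `n = 1`: return a multiple of the only basis vector that is closest to `t`. -/
  | base {B : Fin 1 → Vec m} {t z : Vec m} (a : ℤ)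
      (nearest : ∀ a' : ℤ, vnorm (a • B 0 - t) ≤ vnorm (a' • B 0 - t))
      (ret : z = a • B 0) :
      CVPRun P γ B t z
  /-- `n = k + 2 ≥ 2`. -/
  | step {k : ℕ} {B : Fin (k + 2) → Vec m} {t z₂' z : Vec m} (D : Descent P γ B t)
      (recursion : CVPRun P γ D.projBasis D.projTarget z₂')
      (A : Ascent D z₂' z) :
      CVPRun P γ B t z

variable {P : Polynomial ℕ} {γ : ℝ} {m : ℕ}

/-- The vectors `v` of the successive levels of the recursion. On the last level, where the rank
is one and no oracle is needed, `v` is the only basis vector. -/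
def CVPRun.oracleVectors {n : ℕ} {B : Fin n → Vec m} {t z : Vec m} :
    CVPRun P γ B t z → Fin n → Vec m
  | @CVPRun.base _ _ _ B _ _ _ _ _ => B
  | .step D r _ => Fin.cons D.v r.oracleVectors

/-- The vectors generated on the way to the bases of the successive levels: the vectors `v`, the
reduced bases `b i`, their components along `v`, and their projections, which are the bases of
the recursive calls. -/
def CVPRun.basisVectors {n : ℕ} {B : Fin n → Vec m} {t z : Vec m} :
    CVPRun P γ B t z → List (Vec m)
  | .base _ _ _ => []
  | .step D r _ =>
    D.v :: List.ofFn D.b ++ List.ofFn (fun i => comp D.v (D.b i)) ++ List.ofFn D.projBasis ++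
      r.basisVectors

/-- All other vectors generated: the vectors output and handled internally by the subroutines,
the component and the projection of the target, the integer coefficient vectors, `z₂`, and the
vector returned (so `z₂'` appears as the vector returned by the recursive call). -/
def CVPRun.otherVectors {n : ℕ} {B : Fin n → Vec m} {t z : Vec m} :
    CVPRun P γ B t z → List (List ℚ)
  | .base a _ _ => [[(a : ℚ)], List.ofFn z]
  | .step D r A =>
    List.ofFn D.z₁ :: D.wBDD ++ List.ofFn (fun i => List.ofFn (D.bt i)) ++ D.wFB ++ D.wLLL ++
      [List.ofFn (comp D.v t), List.ofFn D.projTarget,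
        (A.a₁ : ℚ) :: List.ofFn (fun i => (A.a i : ℚ)), List.ofFn A.z₂, List.ofFn z] ++
      r.otherVectors

/-- All vectors generated in a run, as lists of coordinates. -/
def CVPRun.allVectors {n : ℕ} {B : Fin n → Vec m} {t z : Vec m} (r : CVPRun P γ B t z) :
    List (List ℚ) :=
  r.basisVectors.map List.ofFn ++ r.otherVectors

/-- `M = max {n, log γ, log (max_i ‖b_i‖)}`; the second entry is redundant if `γ ≤ 2 ^ n`. -/
def sizeParam {n m : ℕ} (γ : ℝ) (B : Fin n → Vec m) : ℝ :=
  max (n : ℝ) (max (Real.logb 2 γ) (Real.logb 2 (⨆ i, vnorm (B i))))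

end

end CVPReduction

open CVPReduction

/-!
The length of the vectors handled on a level of the recursion does not depend on the depth: the
lattice of every level is the orthogonal projection of the original lattice, so it is generated by
the projections of the original basis vectors. These are no longer than `2 ^ M`, one of
them is non-zero, and hence `v` has length at most `γ * 2 ^ M` (`IsSVPAnswer.vnorm_le`). By Lovász'
condition the Gram–Schmidt vectors of the reduced basis, except for `v`, are at most `2 ^ M` times
as long as the longest generator, and size reduction turns this into a bound on the `b i`
(`IsLLLReducedRel.vnorm_le`).

Bounding denominators level by level would multiply their bit lengths by a constant each time.
Instead, every level remembers integral vectors `X`, one for each level above, such that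
its lattice consists of projections of integral vectors orthogonally to the `X i`; this is the
invariant `Level`. When the vector `v` of a level joins, an integral vector `y` that projects to `v`
is added to `X`. It can be chosen with `‖y‖ ≤ ‖v‖ + ∑ i, ‖X i‖`, so the `X i` grow only
exponentially in the depth, that is, by a linear number of bits. By Cramer's rule a single
determinant, the one of the Gram matrix of `X`, clears all denominators of the level
(`exists_projection_denominator`). A vector of bounded length with a bounded common denominator
has few bits.

For the target side, the distance of the returned vector from the target grows by at most `‖v‖` from
one level to the one above (`CVPRun.vnorm_sub_le`). The integers `a i` are bounded by back
substitution in the orthogonalization of the reduced basis, whose vectors are not too short: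
the first one has a small denominator, and the others are controlled by Lovász' condition
(`IsLLLReducedRel.abs_coeff_le`).

Finally, orthogonalizing `v, y 0, y 1, …` amounts to projecting the `y i` orthogonally to `v` and
orthogonalizing the projections (`gsVec_cons_succ`). So a basis whose Gram–Schmidt vectors are the
vectors of the levels is obtained from the one for the recursive call by lifting its vectors to
the lattice and reducing them modulo `v` (`CVPRun.exists_basis`).
-/

namespace CVPReduction

/-! ### Rational vectors in Euclidean space -/

section Norm

variable {m : ℕ}

lemma toE_apply (v : Vec m) (i : Fin m) : toE v i = (v i : ℝ) := rfl

lemma toE_zero : toE (0 : Vec m) = 0 := by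
  ext i; simp [toE_apply]

lemma toE_add (u v : Vec m) : toE (u + v) = toE u + toE v := by
  ext i; simp [toE_apply]

lemma toE_sub (u v : Vec m) : toE (u - v) = toE u - toE v := by
  ext i; simp [toE_apply]

lemma toE_smul (c : ℚ) (v : Vec m) : toE (c • v) = (c : ℝ) • toE v := by
  ext i; simp [toE_apply]

lemma toE_zsmul (c : ℤ) (v : Vec m) : toE (c • v) = (c : ℝ) • toE v := by
  ext i; simp [toE_apply]

lemma toE_sum {ι : Type*} (s : Finset ι) (f : ι → Vec m) :
    toE (∑ i ∈ s, f i) = ∑ i ∈ s, toE (f i) := by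
  ext j; simp [toE_apply]

lemma inner_toE (u v : Vec m) : inner ℝ (toE u) (toE v) = ((u ⬝ᵥ v : ℚ) : ℝ) := by
  simp [PiLp.inner_apply, toE_apply, dotProduct, mul_comm]

lemma vnorm_nonneg (v : Vec m) : 0 ≤ vnorm v := norm_nonneg _

lemma vnorm_zero : vnorm (0 : Vec m) = 0 := by simp [vnorm, toE_zero]

lemma vnorm_sq (v : Vec m) : vnorm v ^ 2 = ((v ⬝ᵥ v : ℚ) : ℝ) := by
  rw [← inner_toE, real_inner_self_eq_norm_sq]; rfl

lemma vnorm_pos {v : Vec m} (hv : v ≠ 0) : 0 < vnorm v := by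
  have h : 0 < v ⬝ᵥ v :=
    lt_of_le_of_ne (Finset.sum_nonneg fun i _ => mul_self_nonneg (v i))
      (Ne.symm (by simpa [dotProduct_self_eq_zero] using hv))
  have h' : (0 : ℝ) < vnorm v ^ 2 := by rw [vnorm_sq]; exact_mod_cast h
  exact lt_of_le_of_ne (vnorm_nonneg v) fun h0 => by simp [← h0] at h'

lemma vnorm_add_le (u v : Vec m) : vnorm (u + v) ≤ vnorm u + vnorm v := by
  unfold vnorm; rw [toE_add]; exact norm_add_le _ _

lemma vnorm_smul (c : ℚ) (v : Vec m) : vnorm (c • v) = |(c : ℝ)| * vnorm v := by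
  unfold vnorm; rw [toE_smul, norm_smul, Real.norm_eq_abs]

lemma vnorm_zsmul (c : ℤ) (v : Vec m) : vnorm (c • v) = |(c : ℝ)| * vnorm v := by
  unfold vnorm; rw [toE_zsmul, norm_smul, Real.norm_eq_abs]

lemma vnorm_neg (v : Vec m) : vnorm (-v) = vnorm v := by
  simpa [vnorm_zero] using vnorm_zsmul (-1) v

lemma vnorm_sub_le (u v : Vec m) : vnorm (u - v) ≤ vnorm u + vnorm v := by
  unfold vnorm; rw [toE_sub]; exact norm_sub_le _ _

lemma vnorm_sum_le {ι : Type*} (s : Finset ι) (f : ι → Vec m) :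
    vnorm (∑ i ∈ s, f i) ≤ ∑ i ∈ s, vnorm (f i) := by
  unfold vnorm; rw [toE_sum]; exact norm_sum_le _ _

lemma abs_apply_le_vnorm (v : Vec m) (i : Fin m) : |(v i : ℝ)| ≤ vnorm v := by
  exact PiLp.norm_apply_le (toE v) i

lemma vnorm_le_sum_abs (v : Vec m) : vnorm v ≤ ∑ i, |(v i : ℝ)| := by
  have h : v = ∑ i, v i • (Pi.single i 1 : Vec m) := by
    ext j; simp [Finset.sum_apply, Pi.single_apply]
  calc vnorm v = vnorm (∑ i, v i • (Pi.single i 1 : Vec m)) := by rw [← h]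
    _ ≤ ∑ i, vnorm (v i • (Pi.single i 1 : Vec m)) := vnorm_sum_le _ _
    _ = _ := by
      refine Finset.sum_congr rfl fun i _ => ?_
      have h1 : toE (Pi.single i 1 : Vec m) = EuclideanSpace.single i 1 := by
        ext j; by_cases hj : j = i <;> simp [toE_apply, hj]
      rw [vnorm_smul]
      simp [vnorm, h1]

lemma abs_dotProduct_le (u v : Vec m) : |((u ⬝ᵥ v : ℚ) : ℝ)| ≤ vnorm u * vnorm v := by
  rw [← inner_toE]; exact abs_real_inner_le_norm _ _

lemma perp_add_comp (v u : Vec m) : perp v u + comp v u = u := by simp [perp]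

lemma perp_dotProduct_self (v u : Vec m) : perp v u ⬝ᵥ v = 0 := by
  by_cases hv : v ⬝ᵥ v = 0
  · have : v = 0 := dotProduct_self_eq_zero.mp hv
    simp [this]
  · simp [perp, comp, sub_dotProduct, smul_dotProduct, hv]

lemma perp_self (v : Vec m) : perp v v = 0 := by
  by_cases hv : v ⬝ᵥ v = 0
  · have : v = 0 := dotProduct_self_eq_zero.mp hv
    simp [perp, comp, this]
  · simp [perp, comp, hv]

/-- Projection orthogonally to `v`, as a linear map. -/
def perpLin (v : Vec m) : Vec m →ₗ[ℚ] Vec m where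
  toFun := perp v
  map_add' u w := by
    simp only [perp, comp, add_dotProduct, add_div, add_smul]; abel
  map_smul' c u := by
    simp only [perp, comp, smul_dotProduct, smul_sub, smul_smul, RingHom.id_apply, smul_eq_mul,
      mul_div_assoc]

lemma perpLin_apply (v u : Vec m) : perpLin v u = perp v u := rfl

lemma vnorm_sq_perp_comp (v u : Vec m) :
    vnorm (perp v u) ^ 2 + vnorm (comp v u) ^ 2 = vnorm u ^ 2 := by
  have h : perp v u ⬝ᵥ comp v u = 0 := by
    rw [comp, dotProduct_smul, perp_dotProduct_self, smul_zero]
  have h2 : u ⬝ᵥ u = perp v u ⬝ᵥ perp v u + comp v u ⬝ᵥ comp v u := by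
    conv_lhs => rw [← perp_add_comp v u]
    rw [add_dotProduct, dotProduct_add, dotProduct_add, h, dotProduct_comm (comp v u), h]
    ring
  rw [vnorm_sq, vnorm_sq, vnorm_sq, h2]; push_cast; ring

lemma vnorm_perp_le (v u : Vec m) : vnorm (perp v u) ≤ vnorm u := by
  refine (abs_le_of_sq_le_sq' ?_ (vnorm_nonneg u)).2
  nlinarith [vnorm_sq_perp_comp v u, sq_nonneg (vnorm (comp v u))]

lemma vnorm_comp_le (v u : Vec m) : vnorm (comp v u) ≤ vnorm u := by
  refine (abs_le_of_sq_le_sq' ?_ (vnorm_nonneg u)).2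
  nlinarith [vnorm_sq_perp_comp v u, sq_nonneg (vnorm (perp v u))]

end Norm

/-! ### Bit sizes -/

lemma size_le_of_le_two_pow {a e : ℕ} (h : a ≤ 2 ^ e) : a.size ≤ e + 1 :=
  Nat.size_le.mpr (h.trans_lt (Nat.pow_lt_pow_right (by norm_num) (Nat.lt_succ_self e)))

/-- A rational number with a small multiple in `ℤ` has few bits unless it is large. -/
lemma ratBits_le {q : ℚ} {D e f : ℕ} (hD : 0 < D) (hDf : D ≤ 2 ^ f) (hq : |(q : ℝ)| ≤ 2 ^ e)
    (hint : ∃ z : ℤ, (D : ℚ) * q = z) : ratBits q ≤ e + 2 * f + 3 := by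
  obtain ⟨z, hz⟩ := hint
  have hden : q.den ∣ D := by
    have h : q = Rat.divInt z D := by
      rw [Rat.divInt_eq_div, ← hz]; push_cast; field_simp
    have := Rat.den_dvd z D
    rw [← h] at this
    exact_mod_cast this
  have hden' : q.den ≤ 2 ^ f := (Nat.le_of_dvd hD hden).trans hDf
  have hnum : q.num.natAbs ≤ 2 ^ (e + f) := by
    have h1 : ((q.num.natAbs : ℕ) : ℝ) = |(q : ℝ)| * q.den := by
      have h2 : (q : ℝ) * q.den = q.num := by exact_mod_cast Rat.mul_den_eq_num q
      rw [← abs_of_nonneg (Nat.cast_nonneg (α := ℝ) q.den), ← abs_mul, h2, Nat.cast_natAbs]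
      simp
    have h3 : ((q.num.natAbs : ℕ) : ℝ) ≤ ((2 ^ (e + f) : ℕ) : ℝ) := by
      rw [h1, pow_add]; push_cast
      exact mul_le_mul hq (by exact_mod_cast hden') (by positivity) (by positivity)
    exact_mod_cast h3
  have a1 := size_le_of_le_two_pow hden'
  have a2 := size_le_of_le_two_pow hnum
  unfold ratBits; omega

lemma ratBits_intCast_le {a : ℤ} {e : ℕ} (ha : |(a : ℝ)| ≤ 2 ^ e) :
    ratBits (a : ℚ) ≤ e + 3 :=
  ratBits_le (D := 1) (f := 0) one_pos le_rfl (by simpa using ha) ⟨a, by simp⟩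

lemma vecBits_eq_sum {m : ℕ} (v : Vec m) : vecBits v = ∑ i, ratBits (v i) := by
  simp [vecBits, listBits, List.map_ofFn, List.sum_ofFn]

lemma vecBits_le {m : ℕ} {v : Vec m} {c : ℕ} (h : ∀ i, ratBits (v i) ≤ c) :
    vecBits v ≤ m * c := by
  rw [vecBits_eq_sum]
  simpa using Finset.sum_le_card_nsmul Finset.univ _ c fun i _ => h i

lemma famBits_le {n m : ℕ} {B : Fin n → Vec m} {c : ℕ} (h : ∀ i, vecBits (B i) ≤ c) :
    famBits B ≤ n * c := by
  simpa [famBits] using Finset.sum_le_card_nsmul Finset.univ _ c fun i _ => h i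

lemma ratBits_le_vecBits {m : ℕ} (v : Vec m) (i : Fin m) : ratBits (v i) ≤ vecBits v := by
  rw [vecBits_eq_sum]
  exact Finset.single_le_sum (f := fun i => ratBits (v i)) (fun _ _ => Nat.zero_le _)
    (Finset.mem_univ i)

lemma dim_le_vecBits {m : ℕ} (v : Vec m) : m ≤ vecBits v := by
  rw [vecBits_eq_sum]
  simpa using Finset.card_nsmul_le_sum Finset.univ (fun i => ratBits (v i)) 1
    fun i _ => by unfold ratBits; omega

lemma abs_le_two_pow_ratBits (q : ℚ) : |(q : ℝ)| ≤ 2 ^ ratBits q := by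
  have h1 : |(q : ℝ)| ≤ (q.num.natAbs : ℝ) := by
    have h2 : (q : ℝ) * q.den = q.num := by exact_mod_cast Rat.mul_den_eq_num q
    have h3 : (1 : ℝ) ≤ q.den := by exact_mod_cast q.pos
    rw [Nat.cast_natAbs, Int.cast_abs, ← h2, abs_mul, abs_of_nonneg (by linarith : (0:ℝ) ≤ q.den)]
    nlinarith [abs_nonneg (q : ℝ)]
  have h4 : q.num.natAbs ≤ 2 ^ ratBits q :=
    (Nat.lt_size_self _).le.trans (Nat.pow_le_pow_right (by norm_num) (by unfold ratBits; omega))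
  exact h1.trans (by exact_mod_cast h4)

lemma vnorm_le_two_pow_vecBits {m : ℕ} (v : Vec m) : vnorm v ≤ 2 ^ (2 * vecBits v) := by
  calc vnorm v ≤ ∑ i, |(v i : ℝ)| := vnorm_le_sum_abs v
    _ ≤ ∑ _i : Fin m, (2 : ℝ) ^ vecBits v := Finset.sum_le_sum fun i _ =>
      (abs_le_two_pow_ratBits _).trans
        (pow_le_pow_right₀ (by norm_num) (ratBits_le_vecBits v i))
    _ = m * 2 ^ vecBits v := by simp
    _ ≤ 2 ^ vecBits v * 2 ^ vecBits v := by
      gcongr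
      exact_mod_cast (Nat.lt_two_pow_self (n := m)).le.trans
        (Nat.pow_le_pow_right (by norm_num) (dim_le_vecBits v))
    _ = _ := by rw [← pow_add, two_mul]

/-! ### Integral vectors -/

/-- The vectors with integral coordinates. -/
def intVec (m : ℕ) : Submodule ℤ (Vec m) where
  carrier := {u | ∀ j, ∃ z : ℤ, u j = z}
  add_mem' {u w} hu hw j := by
    obtain ⟨a, ha⟩ := hu j
    obtain ⟨b, hb⟩ := hw j
    exact ⟨a + b, by simp [ha, hb]⟩
  zero_mem' j := ⟨0, by simp⟩
  smul_mem' c u hu j := by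
    obtain ⟨a, ha⟩ := hu j
    exact ⟨c * a, by simp [ha]⟩

/-- The product of the denominators of the coordinates clears them. -/
lemma exists_target_denominator {m : ℕ} (t : Vec m) :
    ∃ T : ℕ, 0 < T ∧ T ≤ 2 ^ vecBits t ∧ (T : ℚ) • t ∈ intVec m := by
  refine ⟨∏ i, (t i).den, Finset.prod_pos fun i _ => (t i).pos, ?_, fun j => ?_⟩
  · rw [vecBits_eq_sum, ← Finset.prod_pow_eq_pow_sum]
    exact Finset.prod_le_prod' fun i _ => (Nat.lt_size_self _).le.trans
      (Nat.pow_le_pow_right (by norm_num) (by unfold ratBits; omega))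
  · refine ⟨(∏ i ∈ Finset.univ.erase j, ((t i).den : ℤ)) * (t j).num, ?_⟩
    rw [← Finset.mul_prod_erase Finset.univ _ (Finset.mem_univ j)]
    have := Rat.mul_den_eq_num (t j)
    simp only [Pi.smul_apply, smul_eq_mul]
    push_cast
    rw [← this]; ring

/-- A non-zero vector with a small integral multiple is not too short. -/
lemma one_le_mul_vnorm {m : ℕ} {u : Vec m} (hu : u ≠ 0) {D : ℕ}
    (hint : (D : ℚ) • u ∈ intVec m) (hD : 0 < D) : 1 ≤ (D : ℝ) * vnorm u := by
  obtain ⟨j, hj⟩ := Function.ne_iff.mp hu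
  obtain ⟨z, hz⟩ := hint j
  have hz' : (D : ℚ) * u j = z := by simpa using hz
  have hz0 : z ≠ 0 := by
    rintro rfl
    have : (D : ℚ) ≠ 0 := by exact_mod_cast hD.ne'
    simp_all
  have h1 : (1 : ℝ) ≤ |(z : ℝ)| := by exact_mod_cast Int.one_le_abs hz0
  have h2 : (z : ℝ) = D * (u j : ℝ) := by exact_mod_cast hz'.symm
  rw [h2, abs_mul, abs_of_nonneg (Nat.cast_nonneg (α := ℝ) D)] at h1
  exact h1.trans (mul_le_mul_of_nonneg_left (abs_apply_le_vnorm u j) (Nat.cast_nonneg _))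

lemma ratBits_apply_le {m : ℕ} {u : Vec m} {D e f : ℕ} (hD : 0 < D) (hDf : D ≤ 2 ^ f)
    (hu : vnorm u ≤ 2 ^ e) (hint : (D : ℚ) • u ∈ intVec m) (j : Fin m) :
    ratBits (u j) ≤ e + 2 * f + 3 :=
  ratBits_le hD hDf ((abs_apply_le_vnorm u j).trans hu) (by simpa using hint j)

/-! ### Projections and their denominators -/

/-- `p` is the component of `u` orthogonal to all the vectors `X i`. -/
def IsProj {ℓ m : ℕ} (X : Fin ℓ → Vec m) (u p : Vec m) : Prop :=
  u - p ∈ Submodule.span ℚ (Set.range X) ∧ ∀ i, p ⬝ᵥ X i = 0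

/-- Cramer's rule: the Gram determinant of integral vectors `X i` clears the denominators which
the projection orthogonal to them introduces. -/
lemma exists_projection_denominator {ℓ m e : ℕ} {X : Fin ℓ → Vec m}
    (hint : ∀ i, X i ∈ intVec m) (hX : LinearIndependent ℚ X) (hnorm : ∀ i, vnorm (X i) ≤ 2 ^ e) :
    ∃ D : ℕ, 0 < D ∧ D ≤ 2 ^ (ℓ * ℓ + 2 * e * ℓ) ∧ ∀ u p : Vec m, IsProj X u p →
      ∀ T : ℕ, (T : ℚ) • u ∈ intVec m → ((D * T : ℕ) : ℚ) • p ∈ intVec m := by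
  choose x hx using hint
  let A : Matrix (Fin ℓ) (Fin ℓ) ℤ := Matrix.of fun i j => ∑ c, x i c * x j c
  have hA : ∀ i j, ((A i j : ℤ) : ℚ) = X i ⬝ᵥ X j := fun i j => by
    simp [A, dotProduct, hx]
  have hA0 : A.det ≠ 0 := by
    intro h0
    obtain ⟨w, hw0, hw⟩ := Matrix.exists_mulVec_eq_zero_iff.mpr h0
    have h1 : ∀ i, X i ⬝ᵥ (∑ j, (w j : ℚ) • X j) = 0 := fun i => by
      have := congrFun hw i
      simp only [Matrix.mulVec, dotProduct, Pi.zero_apply] at this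
      rw [dotProduct_sum]
      simp only [dotProduct_smul, ← hA, smul_eq_mul]
      have h2 : ((∑ j, A i j * w j : ℤ) : ℚ) = 0 := by exact_mod_cast this
      rw [← h2]; push_cast
      exact Finset.sum_congr rfl fun j _ => mul_comm _ _
    have h2 : (∑ j, (w j : ℚ) • X j) = 0 := by
      rw [← dotProduct_self_eq_zero]
      rw [sum_dotProduct]
      exact Finset.sum_eq_zero fun i _ => by rw [smul_dotProduct, h1, smul_zero]
    refine hw0 (funext fun j => ?_)
    exact_mod_cast (Fintype.linearIndependent_iff.mp hX _ h2 j)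
  refine ⟨A.det.natAbs, Int.natAbs_pos.mpr hA0, ?_, ?_⟩
  · have hent : ∀ i j, AbsoluteValue.abs (A i j) ≤ (2 ^ (2 * e) : ℤ) := fun i j => by
      have h1 : |((X i ⬝ᵥ X j : ℚ) : ℝ)| ≤ 2 ^ (2 * e) := by
        refine (abs_dotProduct_le _ _).trans ?_
        rw [two_mul, pow_add]
        exact mul_le_mul (hnorm i) (hnorm j) (vnorm_nonneg _) (by positivity)
      rw [← hA] at h1
      show |A i j| ≤ _
      exact_mod_cast h1
    have h2 := Matrix.det_le hent
    have h3 : |A.det| ≤ (ℓ.factorial : ℤ) * (2 ^ (2 * e)) ^ ℓ := by simpa using h2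
    have h4 : ℓ.factorial ≤ 2 ^ (ℓ * ℓ) := (Nat.factorial_le_pow ℓ).trans
      ((Nat.pow_le_pow_left (Nat.lt_two_pow_self).le ℓ).trans_eq (pow_mul _ _ _).symm)
    have h5 : (A.det.natAbs : ℤ) ≤ ((2 ^ (ℓ * ℓ + 2 * e * ℓ) : ℕ) : ℤ) := by
      rw [Int.natCast_natAbs]
      refine h3.trans ?_
      rw [pow_add, pow_mul 2 (2 * e) ℓ]
      push_cast
      gcongr
      exact_mod_cast h4
    exact_mod_cast h5
  · rintro u p ⟨hmem, hperp⟩ T hT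
    obtain ⟨α, hα⟩ := (Submodule.mem_span_range_iff_exists_fun ℚ).mp hmem
    choose s hs using hT
    -- the integral right-hand side of the normal equations
    let c : Fin ℓ → ℤ := fun i => ∑ j, s j * x i j
    have hc : ∀ i, ((c i : ℤ) : ℚ) = ∑ j, (A i j : ℚ) * (T * α j) := fun i => by
      have h1 : u ⬝ᵥ X i = ∑ j, α j * (A i j : ℚ) := by
        have : u = p + ∑ j, α j • X j := by rw [hα]; abel
        rw [this, add_dotProduct, hperp, zero_add, sum_dotProduct]
        refine Finset.sum_congr rfl fun j _ => ?_
        rw [smul_dotProduct, hA, dotProduct_comm, smul_eq_mul]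
      have h2 : ((c i : ℤ) : ℚ) = T * (u ⬝ᵥ X i) := by
        rw [← smul_eq_mul, ← smul_dotProduct]
        simp only [c, dotProduct, hx, hs]
        push_cast; rfl
      rw [h2, h1, Finset.mul_sum]
      exact Finset.sum_congr rfl fun j _ => by ring
    have hsol : ∀ j, (A.det : ℚ) * (T * α j) = ((A.adjugate.mulVec c j : ℤ) : ℚ) := by
      have h1 : (A.map (Int.cast : ℤ → ℚ)).mulVec (fun j => (T : ℚ) * α j) =
          fun i => (c i : ℚ) := by
        funext i; rw [hc]; rfl
      have h2 := congrArg (fun y => (A.adjugate.map (Int.cast : ℤ → ℚ)).mulVec y) h1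
      have h3 : A.adjugate.map (Int.cast : ℤ → ℚ) * A.map (Int.cast : ℤ → ℚ) =
          (A.det : ℚ) • (1 : Matrix (Fin ℓ) (Fin ℓ) ℚ) := by
        have := congrArg (fun N : Matrix (Fin ℓ) (Fin ℓ) ℤ => N.map (Int.castRingHom ℚ))
          (Matrix.adjugate_mul A)
        simp only [Matrix.map_mul] at this
        refine Eq.trans this ?_
        ext i j
        simp only [Matrix.map_apply, Matrix.smul_apply, Matrix.one_apply]
        split <;> simp
      simp only [Matrix.mulVec_mulVec, h3, Matrix.smul_mulVec, Matrix.one_mulVec] at h2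
      intro j
      have h4 := congrFun h2 j
      simp only [Pi.smul_apply, smul_eq_mul] at h4
      rw [h4]
      simp [Matrix.mulVec, dotProduct]
    have hp : (A.det : ℚ) • (T : ℚ) • p ∈ intVec m := by
      have h1 : (A.det : ℚ) • (T : ℚ) • p =
          A.det • ((T : ℚ) • u) - ∑ j, (A.adjugate.mulVec c j) • X j := by
        have : p = u - ∑ j, α j • X j := by rw [hα]; abel
        rw [this, smul_sub, smul_sub, Finset.smul_sum, Finset.smul_sum]
        congr 1
        refine Finset.sum_congr rfl fun j _ => ?_
        rw [smul_smul, smul_smul, mul_assoc, hsol, Int.cast_smul_eq_zsmul]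
      rw [h1]
      exact sub_mem (Submodule.smul_mem _ _ fun j => ⟨s j, hs j⟩)
        (Submodule.sum_mem _ fun j _ => Submodule.smul_mem _ _ fun c => ⟨x j c, hx j c⟩)
    rw [Nat.cast_mul, ← smul_smul]
    generalize A.det = d at hp
    rcases Int.natAbs_eq d with h | h
    · rw [h] at hp; exact_mod_cast hp
    · rw [h] at hp
      simpa using neg_mem hp

/-! ### Gram–Schmidt orthogonalization and LLL-reduced bases -/

section GramSchmidt

open InnerProductSpace

variable {m n : ℕ}

lemma inner_gsVec_of_lt (c : Fin n → Vec m) {i j : Fin n} (h : i < j) :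
    inner ℝ (toE (c i)) (gsVec c j) = 0 := by
  rw [real_inner_comm]
  exact gramSchmidt_inv_triangular ℝ (fun j => toE (c j)) h

lemma inner_gsVec_gsVec (c : Fin n → Vec m) {i j : Fin n} (h : i ≠ j) :
    inner ℝ (gsVec c i) (gsVec c j) = 0 :=
  gramSchmidt_orthogonal ℝ _ h

lemma toE_eq_gsVec_add_sum (c : Fin n → Vec m) (i : Fin n) :
    toE (c i) = gsVec c i + ∑ j ∈ Finset.Iio i, gsCoeff c i j • gsVec c j := by
  have h := gramSchmidt_def'' ℝ (fun j => toE (c j)) i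
  simp only [real_inner_comm (toE (c i))] at h
  exact h

lemma inner_gsVec_self (c : Fin n → Vec m) (i : Fin n) :
    inner ℝ (toE (c i)) (gsVec c i) = ‖gsVec c i‖ ^ 2 := by
  rw [toE_eq_gsVec_add_sum, inner_add_left, real_inner_self_eq_norm_sq, sum_inner,
    Finset.sum_eq_zero, add_zero]
  intro j hj
  rw [inner_smul_left, inner_gsVec_gsVec c (Finset.mem_Iio.mp hj).ne, mul_zero]

lemma gsCoeff_mul_norm_sq (c : Fin n → Vec m) (i j : Fin n) :
    gsCoeff c i j * ‖gsVec c j‖ ^ 2 = inner ℝ (toE (c i)) (gsVec c j) := by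
  by_cases h : gsVec c j = 0
  · simp [h]
  · have : ‖gsVec c j‖ ≠ 0 := norm_ne_zero_iff.mpr h
    rw [gsCoeff]; field_simp

lemma gsVec_zero (c : Fin (n + 1) → Vec m) : gsVec c 0 = toE (c 0) := by
  rw [gsVec]; exact gramSchmidt_bot ℝ fun j => toE (c j)

/-- Among the generators of a lattice, one is at least as long as some Gram–Schmidt vector of
index `≥ j`: a generator that is not orthogonal to the `j`-th one involves a basis vector of
index `≥ j`, and the last basis vector it involves has an integral coefficient. -/
lemma exists_norm_gsVec_le {c : Fin n → Vec m} {S : Set (Vec m)}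
    (hS : lattice c = Submodule.span ℤ S) {j : Fin n} (hj : gsVec c j ≠ 0) :
    ∃ s ∈ S, ∃ i, j ≤ i ∧ ‖gsVec c i‖ ≤ vnorm s := by
  obtain ⟨s, hs, hsj⟩ : ∃ s ∈ S, inner ℝ (toE s) (gsVec c j) ≠ 0 := by
    by_contra! hall
    have h1 : c j ∈ Submodule.span ℤ S := hS ▸ Submodule.subset_span ⟨j, rfl⟩
    have h2 : ∀ u ∈ Submodule.span ℤ S, inner ℝ (toE u) (gsVec c j) = 0 := fun u hu => by
      induction hu using Submodule.span_induction with
      | mem x hx => exact hall x hx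
      | zero => simp [toE_zero]
      | add x y _ _ hx hy => rw [toE_add, inner_add_left, hx, hy, add_zero]
      | smul a x _ hx => rw [toE_zsmul, inner_smul_left, hx, mul_zero]
    have h3 := h2 _ h1
    rw [inner_gsVec_self] at h3
    exact hj (norm_eq_zero.mp (by simpa using h3))
  have hmem : s ∈ lattice c := hS ▸ Submodule.subset_span hs
  obtain ⟨a, rfl⟩ := (Submodule.mem_span_range_iff_exists_fun ℤ).mp hmem
  have hinner : ∀ i, inner ℝ (toE (∑ l, a l • c l)) (gsVec c i) =
      ∑ l, (a l : ℝ) * inner ℝ (toE (c l)) (gsVec c i) := fun i => by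
    rw [toE_sum, sum_inner]
    exact Finset.sum_congr rfl fun l _ => by rw [toE_zsmul, inner_smul_left]; rfl
  rw [hinner] at hsj
  obtain ⟨l, -, hl⟩ := Finset.exists_ne_zero_of_sum_ne_zero hsj
  have hal : a l ≠ 0 := fun h => hl (by simp [h])
  have hjl : j ≤ l := by
    by_contra! h
    exact hl (by rw [inner_gsVec_of_lt c h, mul_zero])
  let F := Finset.univ.filter fun i => a i ≠ 0
  have hlF : l ∈ F := by simp [F, hal]
  set i := F.max' ⟨l, hlF⟩ with hi
  have hiF : a i ≠ 0 := (Finset.mem_filter.mp (F.max'_mem ⟨l, hlF⟩)).2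
  refine ⟨_, hs, i, hjl.trans (F.le_max' l hlF), ?_⟩
  have h1 : inner ℝ (toE (∑ l, a l • c l)) (gsVec c i) = a i * ‖gsVec c i‖ ^ 2 := by
    rw [hinner, Finset.sum_eq_single i, inner_gsVec_self]
    · intro l _ hli
      by_cases hal : a l = 0
      · simp [hal]
      · have : l ≤ i := F.le_max' l (by simp [F, hal])
        rw [inner_gsVec_of_lt c (lt_of_le_of_ne this hli), mul_zero]
    · simp
  have h2 := abs_real_inner_le_norm (toE (∑ l, a l • c l)) (gsVec c i)
  rw [h1, abs_mul, abs_of_nonneg (sq_nonneg ‖gsVec c i‖)] at h2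
  have h3 : (1 : ℝ) ≤ |(a i : ℝ)| := by exact_mod_cast Int.one_le_abs hiF
  by_contra! h4
  have h5 : 0 < ‖gsVec c i‖ := (vnorm_nonneg _).trans_lt h4
  have h6 : ‖toE (∑ l, a l • c l)‖ < ‖gsVec c i‖ := h4
  nlinarith [sq_nonneg ‖gsVec c i‖]

end GramSchmidt

section LLL

variable {m k : ℕ} {v : Vec m} {b : Fin k → Vec m}

/-- Lovász' condition: the Gram–Schmidt vectors after the first one shrink at most geometrically. -/
lemma IsLLLReducedRel.norm_gsVec_le (h : IsLLLReducedRel v b) {i j : Fin (k + 1)}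
    (hj : 1 ≤ j.val) (hji : j ≤ i) :
    ‖gsVec (Fin.cons v b : Fin (k + 1) → Vec m) j‖ ≤
      2 ^ (i.val - j.val) * ‖gsVec (Fin.cons v b : Fin (k + 1) → Vec m) i‖ := by
  obtain ⟨hsize, hlov⟩ := h
  set c : Fin (k + 1) → Vec m := Fin.cons v b
  obtain ⟨d, hd⟩ : ∃ d, i.val = j.val + d := Nat.exists_eq_add_of_le hji
  induction d generalizing i with
  | zero =>
    have : i = j := Fin.ext (by simpa using hd)
    simp [this]
  | succ d ih =>
    let i' : Fin (k + 1) := ⟨j.val + d, by omega⟩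
    have h1 := ih (i := i') (Fin.le_def.mpr (by simp [i'])) rfl
    have hlt : i' < i := Fin.lt_def.mpr (by simp [i']; omega)
    have h2 := hlov i i' (by simp [i']; omega) (by simp [i']; omega)
    have h3 := hsize i i' hlt
    have h4 : gsCoeff c i i' ^ 2 ≤ 1 / 4 := by
      rw [← sq_abs]; nlinarith [abs_nonneg (gsCoeff c i i')]
    have h5 : ‖gsVec c i'‖ ^ 2 ≤ (2 * ‖gsVec c i‖) ^ 2 := by
      nlinarith [sq_nonneg ‖gsVec c i'‖, sq_nonneg ‖gsVec c i‖]
    have h6 : ‖gsVec c i'‖ ≤ 2 * ‖gsVec c i‖ := (abs_le_of_sq_le_sq' h5 (by positivity)).2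
    have e1 : i'.val - j.val = d := by simp [i']
    have e2 : i.val - j.val = d + 1 := by omega
    rw [e1] at h1
    rw [e2, pow_succ, mul_assoc]
    exact h1.trans (mul_le_mul_of_nonneg_left h6 (by positivity))

/-- The vectors of an LLL-reduced basis are not much longer than the vectors of any system of
generators of the lattice. -/
lemma IsLLLReducedRel.vnorm_le (h : IsLLLReducedRel v b) {S : Set (Vec m)}
    (hS : lattice (Fin.cons v b : Fin (k + 1) → Vec m) = Submodule.span ℤ S) {W : ℝ}
    (hSW : ∀ s ∈ S, vnorm s ≤ W) (hv : vnorm v ≤ W) (i : Fin k) :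
    vnorm (b i) ≤ (k + 1) * (2 ^ k * W) := by
  have hW : 0 ≤ W := (vnorm_nonneg v).trans hv
  have hW2 : W ≤ 2 ^ k * W := le_mul_of_one_le_left hW (one_le_pow₀ (by norm_num))
  have hg : ∀ j, ‖gsVec (Fin.cons v b : Fin (k + 1) → Vec m) j‖ ≤ 2 ^ k * W := fun j => by
    rcases Nat.eq_zero_or_pos j.val with hj | hj
    · have : j = 0 := Fin.ext hj
      rw [this, gsVec_zero]
      exact le_trans hv hW2
    · by_cases h0 : gsVec (Fin.cons v b : Fin (k + 1) → Vec m) j = 0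
      · rw [h0, norm_zero]; positivity
      obtain ⟨s, hs, i, hji, hle⟩ := exists_norm_gsVec_le hS h0
      refine (h.norm_gsVec_le hj hji).trans ?_
      exact mul_le_mul (pow_le_pow_right₀ (by norm_num) (by omega)) (hle.trans (hSW s hs))
        (norm_nonneg _) (by positivity)
  obtain ⟨hsize, -⟩ := h
  set c : Fin (k + 1) → Vec m := Fin.cons v b with hc
  have hb : vnorm (b i) = ‖toE (c i.succ)‖ := by rw [hc, Fin.cons_succ]; rfl
  rw [hb, toE_eq_gsVec_add_sum]
  calc ‖gsVec c i.succ + ∑ j ∈ Finset.Iio i.succ, gsCoeff c i.succ j • gsVec c j‖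
      ≤ ‖gsVec c i.succ‖ + ∑ j ∈ Finset.Iio i.succ, ‖gsCoeff c i.succ j • gsVec c j‖ :=
        (norm_add_le _ _).trans (by gcongr; exact norm_sum_le _ _)
    _ ≤ ‖gsVec c i.succ‖ + ∑ j ∈ Finset.Iio i.succ, ‖gsVec c j‖ := by
        gcongr with j hj
        rw [norm_smul]
        refine mul_le_of_le_one_left (norm_nonneg _) ?_
        rw [Real.norm_eq_abs]
        linarith [hsize _ _ (Finset.mem_Iio.mp hj)]
    _ = ∑ j ∈ Finset.Iic i.succ, ‖gsVec c j‖ := by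
        rw [← Finset.Iio_insert, Finset.sum_insert (by simp)]
    _ ≤ ∑ j, ‖gsVec c j‖ :=
        Finset.sum_le_sum_of_subset_of_nonneg (Finset.subset_univ _) fun _ _ _ => norm_nonneg _
    _ ≤ ∑ _j : Fin (k + 1), 2 ^ k * W := Finset.sum_le_sum fun j _ => hg j
    _ = _ := by simp

/-- Back substitution at most doubles the bound in each step. -/
lemma add_sum_le_two_pow_mul {ρ : ℝ} : ∀ {k : ℕ} {f : Fin k → ℝ},
    (∀ j, f j ≤ ρ + ∑ i ∈ Finset.Ioi j, f i) → ρ + ∑ i, f i ≤ 2 ^ k * ρ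
  | 0, f, _ => by simp
  | k + 1, f, hf => by
    have h1 := add_sum_le_two_pow_mul (k := k) (f := fun i => f i.succ) fun j => by
      have := hf j.succ
      rwa [← Fin.map_succEmb_Ioi, Finset.sum_map] at this
    have h2 := hf 0
    have h3 : ∑ i ∈ Finset.Ioi (0 : Fin (k + 1)), f i = ∑ i : Fin k, f i.succ := by
      rw [Fin.Ioi_zero_eq_map, Finset.sum_map]; rfl
    rw [Fin.sum_univ_succ, pow_succ]
    linarith

/-- The coefficients of a vector in the projected reduced basis are bounded by its length. -/
lemma IsLLLReducedRel.abs_coeff_le (h : IsLLLReducedRel v b) {ε : ℝ} (hε : 0 < ε)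
    (hε1 : ∀ i : Fin (k + 1), i.val = 1 →
      ε ≤ ‖gsVec (Fin.cons v b : Fin (k + 1) → Vec m) i‖)
    (a : Fin k → ℤ) (j : Fin k) :
    |(a j : ℝ)| ≤ 2 ^ k * (vnorm (∑ i, a i • perp v (b i)) * 2 ^ k / ε) := by
  set c : Fin (k + 1) → Vec m := Fin.cons v b with hc
  set w := ∑ i, a i • perp v (b i) with hw
  set ρ := vnorm w * 2 ^ k / ε with hρ
  have hρ0 : 0 ≤ ρ := div_nonneg (mul_nonneg (vnorm_nonneg _) (by positivity)) hε.le
  have hg : ∀ j : Fin k, ε ≤ 2 ^ k * ‖gsVec c j.succ‖ := fun j => by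
    have hk : 0 < k := j.pos
    let i : Fin (k + 1) := ⟨1, by omega⟩
    refine (hε1 i rfl).trans ((h.norm_gsVec_le (i := j.succ) (j := i) le_rfl
      (Fin.le_def.mpr (by simp [i]))).trans ?_)
    gcongr
    · norm_num
    · simp; omega
  have hinner : ∀ i j : Fin k, inner ℝ (toE (perp v (b i))) (gsVec c j.succ) =
      gsCoeff c i.succ j.succ * ‖gsVec c j.succ‖ ^ 2 := fun i j => by
    have h0 : inner ℝ (toE v) (gsVec c j.succ) = 0 := by
      simpa [hc] using inner_gsVec_of_lt c (Fin.succ_pos j)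
    rw [gsCoeff_mul_norm_sq, perp, comp, toE_sub, inner_sub_left, toE_smul, inner_smul_left, h0]
    simp [hc]
  have key : ∀ j, |(a j : ℝ)| ≤ ρ + ∑ i ∈ Finset.Ioi j, |(a i : ℝ)| := fun j => by
    set G := ‖gsVec c j.succ‖ with hG
    have hG0 : 0 < G := by
      by_contra! h0
      have := hg j
      nlinarith [pow_pos (two_pos (α := ℝ)) k]
    have h1 : inner ℝ (toE w) (gsVec c j.succ) =
        (a j + ∑ i ∈ Finset.Ioi j, a i * gsCoeff c i.succ j.succ) * G ^ 2 := by
      have e1 : ∀ i, inner ℝ (toE (a i • perp v (b i))) (gsVec c j.succ) =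
          (a i : ℝ) * (gsCoeff c i.succ j.succ * G ^ 2) := fun i => by
        rw [toE_zsmul, inner_smul_left, hinner]; rfl
      have e2 : gsCoeff c j.succ j.succ * G ^ 2 = G ^ 2 := by
        rw [gsCoeff_mul_norm_sq, inner_gsVec_self]
      rw [hw, toE_sum, sum_inner, Finset.sum_congr rfl fun i _ => e1 i,
        ← Finset.sum_subset (Finset.subset_univ (Finset.Ici j)), ← Finset.Ioi_insert,
        Finset.sum_insert (by simp), e2, add_mul, Finset.sum_mul]
      · simp only [mul_assoc]
      · intro i _ hi
        have hij : i < j := by simpa using hi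
        rw [gsCoeff_mul_norm_sq, inner_gsVec_of_lt c (Fin.succ_lt_succ_iff.mpr hij), mul_zero]
    have h2 := abs_real_inner_le_norm (toE w) (gsVec c j.succ)
    rw [h1, abs_mul, abs_of_nonneg (sq_nonneg G)] at h2
    have h3 : |a j + ∑ i ∈ Finset.Ioi j, a i * gsCoeff c i.succ j.succ| * G ≤ vnorm w := by
      have : ‖toE w‖ * ‖gsVec c j.succ‖ = vnorm w * G := rfl
      rw [this] at h2
      nlinarith
    have h4 : |a j + ∑ i ∈ Finset.Ioi j, a i * gsCoeff c i.succ j.succ| ≤ ρ := by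
      rw [hρ, le_div_iff₀ hε]
      calc _ ≤ |a j + ∑ i ∈ Finset.Ioi j, a i * gsCoeff c i.succ j.succ| * (2 ^ k * G) :=
            mul_le_mul_of_nonneg_left (hg j) (abs_nonneg _)
        _ = 2 ^ k * (|a j + ∑ i ∈ Finset.Ioi j, a i * gsCoeff c i.succ j.succ| * G) := by ring
        _ ≤ 2 ^ k * vnorm w := by gcongr
        _ = _ := mul_comm _ _
    have h5 : |∑ i ∈ Finset.Ioi j, a i * gsCoeff c i.succ j.succ| ≤
        ∑ i ∈ Finset.Ioi j, |(a i : ℝ)| := by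
      refine (Finset.abs_sum_le_sum_abs _ _).trans (Finset.sum_le_sum fun i hi => ?_)
      rw [abs_mul]
      refine mul_le_of_le_one_right (abs_nonneg _) ?_
      linarith [h.1 i.succ j.succ (Fin.succ_lt_succ_iff.mpr (Finset.mem_Ioi.mp hi))]
    have h6 := abs_sub (a j + ∑ i ∈ Finset.Ioi j, a i * gsCoeff c i.succ j.succ)
      (∑ i ∈ Finset.Ioi j, a i * gsCoeff c i.succ j.succ)
    rw [add_sub_cancel_right] at h6
    linarith
  have h1 := add_sum_le_two_pow_mul key
  have h2 := Finset.single_le_sum (f := fun i => |(a i : ℝ)|) (fun _ _ => abs_nonneg _)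
    (Finset.mem_univ j)
  linarith

end LLL

/-! ### Lattices and their projections -/

section Lattice

variable {m n : ℕ}

lemma mem_lattice_self (B : Fin n → Vec m) (i : Fin n) : B i ∈ lattice B :=
  Submodule.subset_span ⟨i, rfl⟩

lemma linearIndependent_of_lattice_eq {B C : Fin n → Vec m} (h : lattice B = lattice C)
    (hB : LinearIndependent ℚ B) : LinearIndependent ℚ C := by
  have h1 : Submodule.span ℚ (Set.range B) = Submodule.span ℚ (Set.range C) := by
    rw [← Submodule.span_span_of_tower ℤ ℚ (Set.range B),
      ← Submodule.span_span_of_tower ℤ ℚ (Set.range C)]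
    exact congrArg (fun L : Submodule ℤ (Vec m) => Submodule.span ℚ (L : Set (Vec m))) h
  rw [linearIndependent_iff_card_eq_finrank_span] at hB ⊢
  rw [hB, Set.finrank, Set.finrank, h1]

lemma lattice_perp_eq_span {v : Vec m} {b : Fin n → Vec m} {S : Set (Vec m)}
    (hS : lattice (Fin.cons v b : Fin (n + 1) → Vec m) = Submodule.span ℤ S) :
    lattice (fun i => perp v (b i)) = Submodule.span ℤ (perp v '' S) := by
  have h1 : Submodule.map ((perpLin v).restrictScalars ℤ)
      (lattice (Fin.cons v b : Fin (n + 1) → Vec m)) = Submodule.span ℤ (perp v '' S) := by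
    rw [hS, Submodule.map_span]; rfl
  rw [← h1, lattice, lattice, Submodule.map_span, Fin.range_cons, Set.image_insert_eq]
  have h2 : (perpLin v).restrictScalars ℤ v = 0 := perp_self v
  rw [h2, Submodule.span_insert_zero, ← Set.range_comp]; rfl

lemma exists_of_mem_lattice_perp {v : Vec m} {b : Fin n → Vec m} {u : Vec m}
    (hu : u ∈ lattice (fun i => perp v (b i))) :
    ∃ w ∈ lattice (Fin.cons v b : Fin (n + 1) → Vec m), perp v w = u := by
  have h : lattice (fun i => perp v (b i)) = Submodule.map ((perpLin v).restrictScalars ℤ)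
      (lattice (Fin.cons v b : Fin (n + 1) → Vec m)) := by
    rw [lattice_perp_eq_span (Submodule.span_eq _).symm, ← Submodule.span_eq
      (Submodule.map ((perpLin v).restrictScalars ℤ)
        (lattice (Fin.cons v b : Fin (n + 1) → Vec m)))]
    rfl
  rw [h] at hu
  exact hu

lemma linearIndependent_perp {v : Vec m} {b : Fin n → Vec m}
    (h : LinearIndependent ℚ (Fin.cons v b : Fin (n + 1) → Vec m)) :
    LinearIndependent ℚ (fun i => perp v (b i)) := by
  obtain ⟨hb, hv⟩ := linearIndependent_finCons.mp h
  rw [Fintype.linearIndependent_iff]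
  intro a ha
  have h1 : perp v (∑ i, a i • b i) = 0 := by
    rw [← perpLin_apply, map_sum, ← ha]
    exact Finset.sum_congr rfl fun i _ => by rw [map_smul]; rfl
  have h2 : ∑ i, a i • b i = comp v (∑ i, a i • b i) := by
    conv_lhs => rw [← perp_add_comp v (∑ i, a i • b i), h1, zero_add]
  have hmem : ∑ i, a i • b i ∈ Submodule.span ℚ (Set.range b) :=
    Submodule.sum_mem _ fun i _ => Submodule.smul_mem _ _ (Submodule.subset_span ⟨i, rfl⟩)
  rw [comp] at h2
  set c := ((∑ i, a i • b i) ⬝ᵥ v) / (v ⬝ᵥ v) with hc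
  have hc0 : c = 0 := by
    by_contra hc0
    rw [h2] at hmem
    exact hv ((Submodule.smul_mem_iff _ hc0).mp hmem)
  rw [hc0, zero_smul] at h2
  exact Fintype.linearIndependent_iff.mp hb a h2

lemma lambda1_le {B : Fin n → Vec m} {w : Vec m} (hw : w ∈ lattice B) (hw0 : w ≠ 0) :
    lambda1 B ≤ vnorm w :=
  csInf_le ⟨0, by rintro _ ⟨u, -, -, rfl⟩; exact vnorm_nonneg u⟩ ⟨w, hw, hw0, rfl⟩

lemma IsSVPAnswer.ne_zero {γ : ℝ} {B : Fin n → Vec m} {v : Vec m} (h : IsSVPAnswer γ B v) :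
    v ≠ 0 := by
  rintro rfl
  simpa [vnorm_zero] using h.2.1

/-- The answer of the oracle is at most `γ` times as long as the longest vector of any system of
generators, since one of them is a non-zero lattice vector. -/
lemma IsSVPAnswer.vnorm_le {γ R : ℝ} (hγ : 0 ≤ γ) {B : Fin n → Vec m} {v : Vec m}
    (h : IsSVPAnswer γ B v) {S : Set (Vec m)} (hS : lattice B = Submodule.span ℤ S)
    (hR : ∀ s ∈ S, vnorm s ≤ R) : vnorm v ≤ γ * R := by
  obtain ⟨s, hs, hs0⟩ : ∃ s ∈ S, s ≠ 0 := by
    by_contra! hall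
    have h1 : lattice B = ⊥ := by rw [hS, Submodule.span_eq_bot]; exact hall
    have h2 := h.1.1
    rw [h1, Submodule.mem_bot] at h2
    exact h.ne_zero h2
  refine h.2.2.trans (mul_le_mul_of_nonneg_left ?_ hγ)
  exact (lambda1_le (hS ▸ Submodule.subset_span hs) hs0).trans (hR s hs)

end Lattice

section Proj

variable {m ℓ : ℕ} {X : Fin ℓ → Vec m}

lemma dotProduct_eq_zero_of_mem_span {u w : Vec m} (hu : ∀ i, u ⬝ᵥ X i = 0)
    (hw : w ∈ Submodule.span ℚ (Set.range X)) : u ⬝ᵥ w = 0 := by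
  induction hw using Submodule.span_induction with
  | mem x hx => obtain ⟨i, rfl⟩ := hx; exact hu i
  | zero => simp
  | add x y _ _ hx hy => rw [dotProduct_add, hx, hy, add_zero]
  | smul a x _ hx => rw [dotProduct_smul, hx, smul_zero]

/-- Projecting orthogonally to `v` as well amounts to one more vector `y`, of which `v` is the
projection. -/
lemma IsProj.cons {y v w u : Vec m} (hv : IsProj X y v) (hu : IsProj X w u) :
    IsProj (Fin.cons y X : Fin (ℓ + 1) → Vec m) w (perp v u) := by
  have hle : Submodule.span ℚ (Set.range X) ≤
      Submodule.span ℚ (Set.range (Fin.cons y X : Fin (ℓ + 1) → Vec m)) := by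
    rw [Fin.range_cons]; exact Submodule.span_mono (Set.subset_insert _ _)
  have hvmem : v ∈ Submodule.span ℚ (Set.range (Fin.cons y X : Fin (ℓ + 1) → Vec m)) := by
    have h1 : v = y - (y - v) := by abel
    rw [h1]
    exact sub_mem (Submodule.subset_span ⟨0, rfl⟩) (hle hv.1)
  have hX : ∀ i, perp v u ⬝ᵥ X i = 0 := fun i => by
    rw [perp, comp, sub_dotProduct, smul_dotProduct, hu.2, hv.2, smul_zero, sub_zero]
  refine ⟨?_, fun i => ?_⟩
  · have h1 : w - perp v u = (w - u) + comp v u := by rw [perp]; abel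
    rw [h1]
    exact add_mem (hle hu.1) (Submodule.smul_mem _ _ hvmem)
  · refine Fin.cases ?_ (fun i => ?_) i
    · have h1 : y = v + (y - v) := by abel
      rw [Fin.cons_zero, h1, dotProduct_add, perp_dotProduct_self,
        dotProduct_eq_zero_of_mem_span hX hv.1, add_zero]
    · rw [Fin.cons_succ]; exact hX i

/-- A projected integral vector is the projection of an integral vector that is longer by at most
the total length of the `X i`. -/
lemma IsProj.exists_short (hint : ∀ i, X i ∈ intVec m) {y v : Vec m} (hy : y ∈ intVec m)
    (hv : IsProj X y v) :
    ∃ y' ∈ intVec m, IsProj X y' v ∧ vnorm y' ≤ vnorm v + ∑ i, vnorm (X i) := by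
  obtain ⟨α, hα⟩ := (Submodule.mem_span_range_iff_exists_fun ℚ).mp hv.1
  have h1 : y - ∑ j, ⌊α j⌋ • X j = v + ∑ j, Int.fract (α j) • X j := by
    have h2 : y = v + ∑ j, α j • X j := by rw [hα]; abel
    rw [h2, add_sub_assoc, ← Finset.sum_sub_distrib]
    congr 1
    refine Finset.sum_congr rfl fun j _ => ?_
    rw [Int.fract, sub_smul, Int.cast_smul_eq_zsmul]
  refine ⟨y - ∑ j, ⌊α j⌋ • X j, sub_mem hy (Submodule.sum_mem _ fun j _ =>
    Submodule.smul_mem _ _ (hint j)), ⟨?_, hv.2⟩, ?_⟩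
  · rw [h1, add_sub_cancel_left]
    exact Submodule.sum_mem _ fun j _ => Submodule.smul_mem _ _ (Submodule.subset_span ⟨j, rfl⟩)
  · rw [h1]
    refine (vnorm_add_le _ _).trans (add_le_add_right ((vnorm_sum_le _ _).trans
      (Finset.sum_le_sum fun j _ => ?_)) _)
    rw [vnorm_smul]
    refine mul_le_of_le_one_left (vnorm_nonneg _) ?_
    rw [abs_of_nonneg (by exact_mod_cast Int.fract_nonneg (α j))]
    exact_mod_cast (Int.fract_lt_one (α j)).le

end Proj

/-! ### The invariant of the recursion -/

/-- What is known about the input `(B, t)` of a level of the recursion: its lattice and its target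
are the projections of integral vectors and of the original target `t₀` orthogonally to the
span of integral vectors `X`, one for each of the levels above. The number `M` bounds the rank
of the original lattice and the logarithms of `γ` and of the lengths of the original basis
vectors. -/
structure Level (M : ℕ) {m ℓ k : ℕ} (t₀ : Vec m) (X : Fin ℓ → Vec m) (B : Fin k → Vec m)
    (t : Vec m) : Prop where
  rank_le : ℓ + k ≤ M
  integral : ∀ i, X i ∈ intVec m
  indep : LinearIndependent ℚ X
  sum_le : ∑ i, vnorm (X i) ≤ (2 ^ ℓ - 1) * 2 ^ (2 * M)
  basis_indep : LinearIndependent ℚ B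
  proj : ∀ u ∈ lattice B, ∃ y ∈ intVec m, IsProj X y u
  gen : ∃ S : Set (Vec m), lattice B = Submodule.span ℤ S ∧ ∀ s ∈ S, vnorm s ≤ 2 ^ M
  basis_le : ∀ i, vnorm (B i) ≤ 2 ^ (4 * M)
  target : IsProj X t₀ t
  target_le : vnorm t ≤ vnorm t₀

section Step

variable {P : Polynomial ℕ} {γ : ℝ} {M m ℓ k : ℕ} {t₀ t : Vec m} {X : Fin ℓ → Vec m}

lemma Level.vnorm_oracle_le {B : Fin k → Vec m} (h : Level M t₀ X B t) (hγ1 : 1 ≤ γ)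
    (hγ : γ ≤ 2 ^ M) {v : Vec m} (hv : IsSVPAnswer γ B v) : vnorm v ≤ 2 ^ (2 * M) := by
  obtain ⟨S, hS, hSM⟩ := h.gen
  refine (hv.vnorm_le (by linarith) hS hSM).trans ?_
  rw [two_mul, pow_add]
  gcongr

variable {B : Fin (k + 2) → Vec m}

lemma Descent.lattice_eq (D : Descent P γ B t) :
    lattice (Fin.cons D.v D.b : Fin (k + 2) → Vec m) = lattice B := D.lll_lattice.trans D.fb

lemma Descent.b_mem (D : Descent P γ B t) (i : Fin (k + 1)) : D.b i ∈ lattice B := by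
  rw [← D.lattice_eq]
  exact Submodule.subset_span ⟨i.succ, rfl⟩

lemma Level.vnorm_b_le (h : Level M t₀ X B t) (hγ1 : 1 ≤ γ) (hγ : γ ≤ 2 ^ M)
    (D : Descent P γ B t) (i : Fin (k + 1)) : vnorm (D.b i) ≤ 2 ^ (4 * M) := by
  obtain ⟨S, hS, hSM⟩ := h.gen
  have h1 := D.lll_reduced.vnorm_le (D.lattice_eq.trans hS) (W := 2 ^ (2 * M))
    (fun s hs => (hSM s hs).trans (pow_le_pow_right₀ (by norm_num) (by omega)))
    (h.vnorm_oracle_le hγ1 hγ D.oracle) i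
  have hk : k + 2 ≤ M := le_trans (by omega) h.rank_le
  refine h1.trans ?_
  have h2 : (((k + 1 : ℕ) : ℝ) + 1) ≤ 2 ^ M := by
    have : k + 1 + 1 ≤ 2 ^ M := hk.trans Nat.lt_two_pow_self.le
    exact_mod_cast this
  have h3 : (2 : ℝ) ^ (k + 1) ≤ 2 ^ M := pow_le_pow_right₀ (by norm_num) (by omega)
  calc _ ≤ (2 : ℝ) ^ M * (2 ^ M * 2 ^ (2 * M)) := by gcongr
    _ = _ := by rw [← pow_add, ← pow_add]; congr 1; ring

/-- The invariant passes to the recursive call. -/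
lemma Level.step (h : Level M t₀ X B t) (hγ1 : 1 ≤ γ) (hγ : γ ≤ 2 ^ M) (D : Descent P γ B t) :
    ∃ y, Level M t₀ (Fin.cons y X : Fin (ℓ + 1) → Vec m) D.projBasis D.projTarget := by
  have hv := h.vnorm_oracle_le hγ1 hγ D.oracle
  obtain ⟨y₀, hy₀, hyv₀⟩ := h.proj D.v D.oracle.1.1
  obtain ⟨y, hy, hyv, hyle⟩ := hyv₀.exists_short h.integral hy₀
  obtain ⟨S, hS, hSM⟩ := h.gen
  refine ⟨y, by have := h.rank_le; omega, ?_, ?_, ?_, ?_, ?_, ?_, ?_, hyv.cons h.target,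
    (vnorm_perp_le _ _).trans h.target_le⟩
  · exact Fin.cases hy h.integral
  · refine linearIndependent_finCons.mpr ⟨h.indep, fun hmem => D.oracle.ne_zero ?_⟩
    have h1 : D.v ∈ Submodule.span ℚ (Set.range X) := by
      have : D.v = y - (y - D.v) := by abel
      rw [this]; exact sub_mem hmem hyv.1
    exact dotProduct_self_eq_zero.mp (dotProduct_eq_zero_of_mem_span hyv.2 h1)
  · rw [Fin.sum_univ_succ]
    simp only [Fin.cons_zero, Fin.cons_succ]
    have := h.sum_le
    rw [pow_succ]
    nlinarith
  · exact linearIndependent_perp (linearIndependent_of_lattice_eq D.lattice_eq.symm h.basis_indep)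
  · intro u hu
    obtain ⟨w, hw, rfl⟩ := exists_of_mem_lattice_perp hu
    rw [D.lattice_eq] at hw
    obtain ⟨x, hx, hxw⟩ := h.proj w hw
    exact ⟨x, hx, hyv.cons hxw⟩
  · refine ⟨perp D.v '' S, lattice_perp_eq_span (D.lattice_eq.trans hS), ?_⟩
    rintro _ ⟨s, hs, rfl⟩
    exact (vnorm_perp_le _ _).trans (hSM s hs)
  · exact fun i => (vnorm_perp_le _ _).trans (h.vnorm_b_le hγ1 hγ D i)

/-- On every level one small denominator serves for the whole lattice, and for the target up to
the denominator of the original target. -/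
lemma Level.exists_denominator {B : Fin k → Vec m} (h : Level M t₀ X B t) :
    ∃ D : ℕ, 0 < D ∧ D ≤ 2 ^ (7 * M ^ 2) ∧ (∀ u ∈ lattice B, (D : ℚ) • u ∈ intVec m) ∧
      ∀ T : ℕ, (T : ℚ) • t₀ ∈ intVec m → ((D * T : ℕ) : ℚ) • t ∈ intVec m := by
  have hℓ : ℓ ≤ M := le_trans (Nat.le_add_right _ _) h.rank_le
  -- the Gram matrix of `X` has entries up to `2 ^ (6 * M)`, and `ℓ ! ≤ 2 ^ (ℓ * ℓ)`
  have hnorm : ∀ i, vnorm (X i) ≤ 2 ^ (3 * M) := fun i => by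
    have h1 := Finset.single_le_sum (f := fun i => vnorm (X i)) (fun i _ => vnorm_nonneg _)
      (Finset.mem_univ i)
    refine h1.trans (h.sum_le.trans ?_)
    have h2 : (2 : ℝ) ^ ℓ ≤ 2 ^ M := pow_le_pow_right₀ (by norm_num) hℓ
    calc ((2 : ℝ) ^ ℓ - 1) * 2 ^ (2 * M) ≤ 2 ^ M * 2 ^ (2 * M) := by gcongr; linarith
      _ = _ := by rw [← pow_add]; congr 1; ring
  obtain ⟨D, hD, hDle, hDp⟩ := exists_projection_denominator h.integral h.indep hnorm
  refine ⟨D, hD, hDle.trans (Nat.pow_le_pow_right (by norm_num) ?_), fun u hu => ?_,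
    fun T hT => hDp _ _ h.target T hT⟩
  · nlinarith
  · obtain ⟨y, hy, hyu⟩ := h.proj u hu
    simpa using hDp y u hyu 1 (by simpa using hy)

end Step

/-! ### A basis whose orthogonalization consists of the vectors of the levels -/

section Basis

variable {m n : ℕ}

lemma sum_Iio_eq_sum_ite {E : Type*} [AddCommMonoid E] (i : Fin n) (f : Fin n → E) :
    ∑ j ∈ Finset.Iio i, f j = ∑ j, if j < i then f j else 0 := by
  rw [← Finset.sum_filter]
  congr 1
  ext j; simp

/-- Orthogonalizing `v, y 0, y 1, …` is the same as projecting the `y i` orthogonally to `v` and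
then orthogonalizing the projections. -/
lemma gsVec_cons_succ (v : Vec m) (y : Fin n → Vec m) (i : Fin n) :
    gsVec (Fin.cons v y : Fin (n + 1) → Vec m) i.succ = gsVec (fun i => perp v (y i)) i := by
  induction i using WellFoundedLT.induction with
  | ind i ih =>
    set c : Fin (n + 1) → Vec m := Fin.cons v y with hc
    set p : Fin n → Vec m := fun i => perp v (y i) with hp
    have h1 := toE_eq_gsVec_add_sum c i.succ
    have h2 := toE_eq_gsVec_add_sum p i
    rw [sum_Iio_eq_sum_ite] at h1 h2
    rw [Fin.sum_univ_succ, if_pos (Fin.succ_pos i)] at h1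
    have h3 : ∀ j, (if j.succ < i.succ then gsCoeff c i.succ j.succ • gsVec c j.succ else 0) =
        if j < i then gsCoeff p i j • gsVec p j else 0 := fun j => by
      simp only [Fin.succ_lt_succ_iff]
      split_ifs with hj
      · have h0 : inner ℝ (toE v) (gsVec c j.succ) = 0 := by
          simpa [hc] using inner_gsVec_of_lt c (Fin.succ_pos j)
        have h4 : inner ℝ (toE (p i)) (gsVec c j.succ) =
            inner ℝ (toE (c i.succ)) (gsVec c j.succ) := by
          simp only [hp, hc, Fin.cons_succ, perp, comp]
          rw [toE_sub, inner_sub_left, toE_smul, inner_smul_left, h0, mul_zero, sub_zero]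
        rw [gsCoeff, gsCoeff, ← h4, ih j hj]
      · rfl
    have h5 : gsCoeff c i.succ 0 • gsVec c 0 = toE (comp v (y i)) := by
      rw [gsCoeff, gsVec_zero, comp, toE_smul]
      simp only [hc, Fin.cons_zero, Fin.cons_succ]
      rw [← real_inner_self_eq_norm_sq, inner_toE, inner_toE, Rat.cast_div]
    rw [Finset.sum_congr rfl fun j _ => h3 j, h5] at h1
    have h6 : toE (c i.succ) = toE (p i) + toE (comp v (y i)) := by
      rw [← toE_add]; simp only [hp, hc, Fin.cons_succ, perp_add_comp]
    rw [h6, h2] at h1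
    have h7 := h1
    rw [add_comm (toE (comp v (y i))), ← add_assoc] at h7
    exact (add_right_cancel (add_right_cancel h7)).symm

lemma exists_eq_zsmul_of_perp_eq_zero {v : Vec m} {b : Fin n → Vec m}
    (h : LinearIndependent ℚ (Fin.cons v b : Fin (n + 1) → Vec m)) {u : Vec m}
    (hu : u ∈ lattice (Fin.cons v b : Fin (n + 1) → Vec m)) (hu0 : perp v u = 0) :
    ∃ a : ℤ, u = a • v := by
  obtain ⟨a, rfl⟩ := (Submodule.mem_span_range_iff_exists_fun ℤ).mp hu
  refine ⟨a 0, ?_⟩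
  rw [Fin.sum_univ_succ] at hu0 ⊢
  simp only [Fin.cons_zero, Fin.cons_succ] at hu0 ⊢
  have h1 : ∑ i : Fin n, (a i.succ : ℚ) • perp v (b i) = 0 := by
    rw [← hu0, ← perpLin_apply, map_add, map_zsmul, perpLin_apply, perp_self, smul_zero, zero_add,
      map_sum]
    exact Finset.sum_congr rfl fun i _ => by rw [map_zsmul, Int.cast_smul_eq_zsmul]; rfl
  have h2 := Fintype.linearIndependent_iff.mp (linearIndependent_perp h) _ h1
  rw [Finset.sum_eq_zero, add_zero]
  intro i _
  have : a i.succ = 0 := by exact_mod_cast h2 i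
  rw [this, zero_smul]

/-- Lifting the vectors of a basis of the projected lattice completes `v` to a basis. -/
lemma lattice_cons_eq_of_perp {v : Vec m} {b y : Fin n → Vec m}
    (h : LinearIndependent ℚ (Fin.cons v b : Fin (n + 1) → Vec m))
    (hy : ∀ i, y i ∈ lattice (Fin.cons v b : Fin (n + 1) → Vec m))
    (hperp : lattice (fun i => perp v (y i)) = lattice (fun i => perp v (b i))) :
    lattice (Fin.cons v y : Fin (n + 1) → Vec m) =
      lattice (Fin.cons v b : Fin (n + 1) → Vec m) := by
  have hle : lattice (Fin.cons v y : Fin (n + 1) → Vec m) ≤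
      lattice (Fin.cons v b : Fin (n + 1) → Vec m) := by
    refine Submodule.span_le.mpr ?_
    rintro _ ⟨i, rfl⟩
    exact Fin.cases (Submodule.subset_span ⟨0, rfl⟩) hy i
  have hv : v ∈ lattice (Fin.cons v y : Fin (n + 1) → Vec m) := Submodule.subset_span ⟨0, rfl⟩
  refine le_antisymm hle (Submodule.span_le.mpr ?_)
  rintro _ ⟨i, rfl⟩
  refine Fin.cases hv (fun i => ?_) i
  rw [Fin.cons_succ]
  have h1 : perp v (b i) ∈ lattice (fun i => perp v (y i)) :=
    hperp ▸ mem_lattice_self (fun i => perp v (b i)) i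
  obtain ⟨w, hw, hwb⟩ := exists_of_mem_lattice_perp h1
  have h2 : perp v (b i - w) = 0 := by
    rw [← perpLin_apply, map_sub, perpLin_apply, perpLin_apply, hwb, sub_self]
  obtain ⟨a, ha⟩ := exists_eq_zsmul_of_perp_eq_zero h
    (sub_mem (Submodule.subset_span ⟨i.succ, by simp⟩) (hle hw)) h2
  have h3 : b i = a • v + w := by rw [← ha]; abel
  rw [h3]
  exact add_mem (Submodule.smul_mem _ _ hv) hw

lemma exists_zsmul_add_close (v u : Vec m) :
    ∃ a : ℤ, vnorm (a • v + u) ≤ vnorm (perp v u) + vnorm v := by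
  set c := (u ⬝ᵥ v) / (v ⬝ᵥ v) with hc
  refine ⟨-round c, ?_⟩
  have h1 : -round c • v + u = perp v u + (c - round c) • v := by
    conv_lhs => rw [← perp_add_comp v u, comp, ← hc]
    rw [sub_smul, Int.cast_smul_eq_zsmul, neg_smul]; abel
  rw [h1]
  refine (vnorm_add_le _ _).trans (add_le_add_right ?_ _)
  rw [vnorm_smul]
  refine mul_le_of_le_one_left (vnorm_nonneg _) ?_
  have h2 : |c - round c| ≤ 1 := (abs_sub_round c).trans (by norm_num)
  exact_mod_cast h2

/-- The vectors of the successive levels of a run are the Gram–Schmidt vectors of a basis of the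
lattice, no vector of which is longer than all of them together. -/
lemma CVPRun.exists_basis {P : Polynomial ℕ} {γ : ℝ} {B : Fin n → Vec m} {t z : Vec m}
    (r : CVPRun P γ B t z) (hB : LinearIndependent ℚ B) :
    ∃ x : Fin n → Vec m, LinearIndependent ℚ x ∧ lattice x = lattice B ∧
      (∀ i, gsVec x i = toE (r.oracleVectors i)) ∧
      ∀ i, vnorm (x i) ≤ ∑ j, vnorm (r.oracleVectors j) := by
  induction r with
  | @base B t z a hn hr =>
    refine ⟨B, hB, rfl, fun i => ?_, fun i => ?_⟩
    · rw [Subsingleton.elim i 0, gsVec_zero]; rfl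
    · rw [Subsingleton.elim i 0, Fin.sum_univ_one]; rfl
  | @step k B t z₂' z D r A ih =>
    have hD := linearIndependent_of_lattice_eq D.lattice_eq.symm hB
    obtain ⟨x', hx', hlat, hgs, hnorm⟩ := ih (linearIndependent_perp hD)
    have hlift : ∀ i, ∃ y ∈ lattice (Fin.cons D.v D.b : Fin (k + 2) → Vec m),
        perp D.v y = x' i ∧ vnorm y ≤ vnorm (x' i) + vnorm D.v := fun i => by
      have h1 : x' i ∈ lattice D.projBasis := hlat ▸ mem_lattice_self x' i
      obtain ⟨w, hw, hwx⟩ := exists_of_mem_lattice_perp h1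
      obtain ⟨a, ha⟩ := exists_zsmul_add_close D.v w
      refine ⟨a • D.v + w, add_mem (Submodule.smul_mem _ _ (Submodule.subset_span ⟨0, rfl⟩)) hw,
        ?_, hwx ▸ ha⟩
      rw [← perpLin_apply, map_add, map_zsmul, perpLin_apply, perpLin_apply, perp_self, smul_zero,
        zero_add, hwx]
    choose y hymem hyx hynorm using hlift
    have hyx' : (fun i => perp D.v (y i)) = x' := funext hyx
    have hL := lattice_cons_eq_of_perp hD hymem (by rw [hyx', hlat]; rfl)
    refine ⟨Fin.cons D.v y, linearIndependent_of_lattice_eq hL.symm hD, hL.trans D.lattice_eq,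
      fun i => ?_, fun i => ?_⟩
    · refine Fin.cases ?_ (fun i => ?_) i
      · rw [gsVec_zero]; rfl
      · rw [gsVec_cons_succ, hyx', hgs]; rfl
    · have hsum : ∑ j, vnorm ((CVPRun.step D r A).oracleVectors j) =
          vnorm D.v + ∑ j, vnorm (r.oracleVectors j) := by
        rw [Fin.sum_univ_succ]; rfl
      rw [hsum]
      refine Fin.cases ?_ (fun i => ?_) i
      · exact le_add_of_nonneg_right (Finset.sum_nonneg fun _ _ => vnorm_nonneg _)
      · have h1 := hynorm i
        have h2 := hnorm i
        rw [Fin.cons_succ]; linarith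

end Basis

/-! ### Bounds along a run -/

/-- The bound on the number of bits of a coordinate. The leading term allows for a denominator of
`14 * M ^ 2` bits, the product of the denominators of two consecutive levels, both in the
denominator and in the numerator. -/
def coordBound (M : ℕ) : ℕ := 28 * M ^ 2 + 5 * M + 3

section Run

variable {P : Polynomial ℕ} {γ : ℝ} {M m ℓ k : ℕ} {t₀ t : Vec m} {X : Fin ℓ → Vec m}

lemma Level.ratBits_le_of_mem {B : Fin k → Vec m} (h : Level M t₀ X B t) {u : Vec m}
    (hu : u ∈ lattice B) {e : ℕ} (he : vnorm u ≤ 2 ^ e) (heM : e ≤ 14 * M ^ 2 + 5 * M) (j : Fin m) :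
    ratBits (u j) ≤ coordBound M := by
  obtain ⟨D, hD, hDle, hDL, -⟩ := h.exists_denominator
  refine (ratBits_apply_le hD hDle he (hDL u hu) j).trans ?_
  unfold coordBound; omega

lemma Level.ratBits_basis_le {B : Fin k → Vec m} (h : Level M t₀ X B t) (i : Fin k) (j : Fin m) :
    ratBits (B i j) ≤ coordBound M := by
  have : M ≤ M ^ 2 := Nat.le_self_pow two_ne_zero M
  exact h.ratBits_le_of_mem (mem_lattice_self B i) (h.basis_le i) (by omega) j

lemma Level.ratBits_v_le {B : Fin (k + 2) → Vec m} (h : Level M t₀ X B t) (hγ1 : 1 ≤ γ)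
    (hγ : γ ≤ 2 ^ M) (D : Descent P γ B t) (j : Fin m) : ratBits (D.v j) ≤ coordBound M :=
  h.ratBits_le_of_mem D.oracle.1.1 (h.vnorm_oracle_le hγ1 hγ D.oracle) (by omega) j

lemma Level.ratBits_b_le {B : Fin (k + 2) → Vec m} (h : Level M t₀ X B t) (hγ1 : 1 ≤ γ)
    (hγ : γ ≤ 2 ^ M) (D : Descent P γ B t) (i : Fin (k + 1)) (j : Fin m) :
    ratBits (D.b i j) ≤ coordBound M :=
  h.ratBits_le_of_mem (D.b_mem i) (h.vnorm_b_le hγ1 hγ D i) (by omega) j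

lemma Level.ratBits_comp_b_le {B : Fin (k + 2) → Vec m} (h : Level M t₀ X B t) (hγ1 : 1 ≤ γ)
    (hγ : γ ≤ 2 ^ M) (D : Descent P γ B t) (i : Fin (k + 1)) (j : Fin m) :
    ratBits (comp D.v (D.b i) j) ≤ coordBound M := by
  obtain ⟨y, h'⟩ := h.step hγ1 hγ D
  obtain ⟨d, hd, hdle, hdL, -⟩ := h.exists_denominator
  obtain ⟨d', hd', hdle', hdL', -⟩ := h'.exists_denominator
  have hint : ((d * d' : ℕ) : ℚ) • comp D.v (D.b i) ∈ intVec m := by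
    have h1 : ((d * d' : ℕ) : ℚ) • comp D.v (D.b i) =
        (d' : ℤ) • ((d : ℚ) • D.b i) - (d : ℤ) • ((d' : ℚ) • D.projBasis i) := by
      have : comp D.v (D.b i) = D.b i - D.projBasis i := by
        rw [Descent.projBasis, perp]; abel
      rw [this, ← Int.cast_smul_eq_zsmul ℚ, ← Int.cast_smul_eq_zsmul ℚ, smul_smul, smul_smul]
      push_cast
      rw [smul_sub, mul_comm (d' : ℚ)]
    rw [h1]
    exact sub_mem (Submodule.smul_mem _ _ (hdL _ (D.b_mem i)))
      (Submodule.smul_mem _ _ (hdL' _ (mem_lattice_self _ i)))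
  have hle : d * d' ≤ 2 ^ (14 * M ^ 2) := by
    calc d * d' ≤ 2 ^ (7 * M ^ 2) * 2 ^ (7 * M ^ 2) := Nat.mul_le_mul hdle hdle'
      _ = _ := by rw [← pow_add]; congr 1; ring
  refine (ratBits_apply_le (Nat.mul_pos hd hd') hle
    ((vnorm_comp_le _ _).trans (h.vnorm_b_le hγ1 hγ D i)) hint j).trans ?_
  unfold coordBound; omega

/-- The vectors on the way to the bases of the levels have small coordinates. -/
lemma CVPRun.ratBits_basisVectors_le {n : ℕ} {B : Fin n → Vec m} {z : Vec m} (hγ1 : 1 ≤ γ)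
    (hγ : γ ≤ 2 ^ M) (r : CVPRun P γ B t z) (h : Level M t₀ X B t) :
    ∀ u ∈ r.basisVectors, ∀ j, ratBits (u j) ≤ coordBound M := by
  induction r generalizing ℓ with
  | base => simp [CVPRun.basisVectors]
  | @step k B t z₂' z D r A ih =>
    obtain ⟨y, h'⟩ := h.step hγ1 hγ D
    intro u hu j
    simp only [CVPRun.basisVectors, List.mem_append, List.mem_cons, List.mem_ofFn] at hu
    rcases hu with (((rfl | ⟨i, rfl⟩) | ⟨i, rfl⟩) | ⟨i, rfl⟩) | hu
    · exact h.ratBits_v_le hγ1 hγ D j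
    · exact h.ratBits_b_le hγ1 hγ D i j
    · exact h.ratBits_comp_b_le hγ1 hγ D i j
    · exact h'.ratBits_basis_le i j
    · exact ih h' u hu j

lemma CVPRun.oracleVectors_le {n : ℕ} {B : Fin n → Vec m} {z : Vec m} (hγ1 : 1 ≤ γ)
    (hγ : γ ≤ 2 ^ M) (r : CVPRun P γ B t z) (h : Level M t₀ X B t) :
    ∀ i, vnorm (r.oracleVectors i) ≤ 2 ^ (4 * M) ∧
      ∀ j, ratBits (r.oracleVectors i j) ≤ coordBound M := by
  induction r generalizing ℓ with
  | base => exact fun i => ⟨h.basis_le i, h.ratBits_basis_le i⟩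
  | @step k B t z₂' z D r A ih =>
    obtain ⟨y, h'⟩ := h.step hγ1 hγ D
    refine Fin.cases ⟨(h.vnorm_oracle_le hγ1 hγ D.oracle).trans
      (pow_le_pow_right₀ (by norm_num) (by omega)), h.ratBits_v_le hγ1 hγ D⟩ (ih h')

/-! ### Targets, coefficients and lifted vectors -/

lemma Level.vnorm_target_le {B : Fin k → Vec m} (h : Level M t₀ X B t) (ht : vecBits t₀ ≤ M) :
    vnorm t ≤ 2 ^ (2 * M) :=
  h.target_le.trans ((vnorm_le_two_pow_vecBits t₀).trans
    (pow_le_pow_right₀ (by norm_num) (by omega)))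

lemma Level.ratBits_target_le {B : Fin k → Vec m} (h : Level M t₀ X B t) (ht : vecBits t₀ ≤ M)
    (j : Fin m) : ratBits (t j) ≤ coordBound M := by
  obtain ⟨T, hT, hTle, hTint⟩ := exists_target_denominator t₀
  obtain ⟨d, hd, hdle, -, hdt⟩ := h.exists_denominator
  have hle : d * T ≤ 2 ^ (7 * M ^ 2 + M) := by
    rw [pow_add]
    exact Nat.mul_le_mul hdle (hTle.trans (Nat.pow_le_pow_right (by norm_num) ht))
  refine (ratBits_apply_le (Nat.mul_pos hd hT) hle (h.vnorm_target_le ht) (hdt T hTint) j).trans ?_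
  unfold coordBound; omega

lemma Level.ratBits_comp_target_le {B : Fin (k + 2) → Vec m} (h : Level M t₀ X B t) (hγ1 : 1 ≤ γ)
    (hγ : γ ≤ 2 ^ M) (ht : vecBits t₀ ≤ M) (D : Descent P γ B t) (j : Fin m) :
    ratBits (comp D.v t j) ≤ coordBound M := by
  obtain ⟨y, h'⟩ := h.step hγ1 hγ D
  obtain ⟨T, hT, hTle, hTint⟩ := exists_target_denominator t₀
  obtain ⟨d, hd, hdle, -, hdt⟩ := h.exists_denominator
  obtain ⟨d', hd', hdle', -, hdt'⟩ := h'.exists_denominator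
  have hint : ((d * d' * T : ℕ) : ℚ) • comp D.v t ∈ intVec m := by
    have h1 : ((d * d' * T : ℕ) : ℚ) • comp D.v t =
        (d' : ℤ) • (((d * T : ℕ) : ℚ) • t) - (d : ℤ) • (((d' * T : ℕ) : ℚ) • D.projTarget) := by
      have : comp D.v t = t - D.projTarget := by rw [Descent.projTarget, perp]; abel
      rw [this, ← Int.cast_smul_eq_zsmul ℚ, ← Int.cast_smul_eq_zsmul ℚ, smul_smul, smul_smul,
        smul_sub]
      push_cast
      congr 2 <;> ring
    rw [h1]
    exact sub_mem (Submodule.smul_mem _ _ (hdt T hTint)) (Submodule.smul_mem _ _ (hdt' T hTint))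
  have hle : d * d' * T ≤ 2 ^ (14 * M ^ 2 + M) := by
    calc d * d' * T ≤ 2 ^ (7 * M ^ 2) * 2 ^ (7 * M ^ 2) * 2 ^ M :=
          Nat.mul_le_mul (Nat.mul_le_mul hdle hdle')
            (hTle.trans (Nat.pow_le_pow_right (by norm_num) ht))
      _ = _ := by rw [← pow_add, ← pow_add]; congr 1; ring
  refine (ratBits_apply_le (Nat.mul_pos (Nat.mul_pos hd hd') hT) hle
    ((vnorm_comp_le _ _).trans (h.vnorm_target_le ht)) hint j).trans ?_
  unfold coordBound; omega

/-- An integral multiple of a lattice vector that is not long has a small coefficient. -/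
lemma Level.abs_coeff_le_of_mem {B : Fin k → Vec m} (h : Level M t₀ X B t) {u : Vec m}
    (hu : u ∈ lattice B) (hu0 : u ≠ 0) {a : ℤ} {e : ℕ} (ha : vnorm (a • u) ≤ 2 ^ e) :
    |(a : ℝ)| ≤ 2 ^ (e + 7 * M ^ 2) := by
  obtain ⟨d, hd, hdle, hdL, -⟩ := h.exists_denominator
  have h1 := one_le_mul_vnorm hu0 (hdL u hu) hd
  rw [vnorm_zsmul] at ha
  have h2 : (d : ℝ) ≤ 2 ^ (7 * M ^ 2) := by exact_mod_cast hdle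
  calc |(a : ℝ)| ≤ |(a : ℝ)| * (d * vnorm u) := le_mul_of_one_le_right (abs_nonneg _) h1
    _ = (|(a : ℝ)| * vnorm u) * d := by ring
    _ ≤ 2 ^ e * 2 ^ (7 * M ^ 2) := by gcongr
    _ = _ := (pow_add _ _ _).symm

/-- The answer of the recursive call, once lifted, is farther from the target by at most the length
of `v`; the vector returned is at least as close. -/
lemma Ascent.vnorm_sub_le {B : Fin (k + 2) → Vec m} {D : Descent P γ B t} {z₂' z : Vec m}
    (A : Ascent D z₂' z) :
    vnorm (A.z₂ - t) ≤ vnorm (z₂' - D.projTarget) + vnorm D.v := by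
  obtain ⟨a', ha'⟩ := exists_zsmul_add_close D.v (∑ i, A.a i • D.b i - t)
  have h1 : perp D.v (∑ i, A.a i • D.b i - t) = z₂' - D.projTarget := by
    refine Eq.trans ?_ (congrArg (· - D.projTarget) A.coeff.symm)
    rw [Descent.projTarget, ← perpLin_apply, map_sub, map_sum]
    simp only [map_zsmul]; rfl
  rw [h1, ← add_sub_assoc] at ha'
  exact (A.nearest a').trans ha'

lemma CVPRun.vnorm_sub_le {n : ℕ} {B : Fin n → Vec m} {z : Vec m} (hγ1 : 1 ≤ γ)
    (hγ : γ ≤ 2 ^ M) (r : CVPRun P γ B t z) (h : Level M t₀ X B t) (ht : vecBits t₀ ≤ M) :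
    vnorm (z - t) ≤ n * 2 ^ (2 * M) := by
  induction r generalizing ℓ with
  | @base B t z a hn hr =>
    have h1 := hn 0
    rw [← hr, zero_smul, zero_sub, vnorm_neg] at h1
    simpa using h1.trans (h.vnorm_target_le ht)
  | @step k B t z₂' z D r A ih =>
    obtain ⟨y, h'⟩ := h.step hγ1 hγ D
    have h1 := ih h'
    have h2 : vnorm (z - t) ≤ vnorm (A.z₂ - t) := by
      rcases A.ret with ⟨hz, hle⟩ | ⟨hz, -⟩
      · exact (congrArg (fun u => vnorm (u - t)) hz).le.trans hle
      · exact (congrArg (fun u => vnorm (u - t)) hz).le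
    have h3 := A.vnorm_sub_le
    have h4 := h.vnorm_oracle_le hγ1 hγ D.oracle
    push_cast at h1 ⊢
    linarith

lemma vnorm_le_of_sub_le {z t : Vec m} {n : ℕ} (hn : n ≤ M) (h : vnorm (z - t) ≤ n * 2 ^ (2 * M))
    (ht : vnorm t ≤ 2 ^ (2 * M)) : vnorm z ≤ 2 ^ (3 * M) := by
  have h1 : vnorm z ≤ vnorm (z - t) + vnorm t := by
    simpa using vnorm_add_le (z - t) t
  have h2 : (n : ℝ) + 1 ≤ 2 ^ M := by
    have : n + 1 ≤ 2 ^ M := (Nat.succ_le_succ hn).trans Nat.lt_two_pow_self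
    exact_mod_cast this
  calc vnorm z ≤ (n + 1) * 2 ^ (2 * M) := by linarith
    _ ≤ 2 ^ M * 2 ^ (2 * M) := by gcongr
    _ = _ := by rw [← pow_add]; congr 1; ring

variable {B : Fin (k + 2) → Vec m}

lemma Level.abs_coeff_le (h : Level M t₀ X B t) (hγ1 : 1 ≤ γ) (hγ : γ ≤ 2 ^ M)
    (D : Descent P γ B t) (a : Fin (k + 1) → ℤ)
    (ha : vnorm (∑ i, a i • D.projBasis i) ≤ 2 ^ (3 * M)) (j : Fin (k + 1)) :
    |(a j : ℝ)| ≤ 2 ^ (7 * M ^ 2 + 5 * M) := by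
  obtain ⟨y, h'⟩ := h.step hγ1 hγ D
  obtain ⟨d, hd, hdle, hdL, -⟩ := h'.exists_denominator
  have hd0 : (0 : ℝ) < d := by exact_mod_cast hd
  have h1 := one_le_mul_vnorm (h'.basis_indep.ne_zero 0) (hdL _ (mem_lattice_self _ 0)) hd
  have hk : k + 1 ≤ M := le_trans (by omega) h.rank_le
  have h2 : (2 : ℝ) ^ (k + 1) ≤ 2 ^ M := pow_le_pow_right₀ (by norm_num) hk
  have h3 : (d : ℝ) ≤ 2 ^ (7 * M ^ 2) := by exact_mod_cast hdle
  have h4 := D.lll_reduced.abs_coeff_le (ε := 1 / d) (by positivity) (fun i hi => by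
    have : i = Fin.succ 0 := Fin.ext hi
    rw [this, gsVec_cons_succ, gsVec_zero, div_le_iff₀ hd0, mul_comm]
    exact h1) a j
  refine h4.trans ?_
  have h5 := vnorm_nonneg (∑ i, a i • D.projBasis i)
  calc _ = (2 : ℝ) ^ (k + 1) * (vnorm (∑ i, a i • D.projBasis i) * 2 ^ (k + 1) * d) := by
        rw [div_div_eq_mul_div, div_one]; rfl
    _ ≤ 2 ^ M * (2 ^ (3 * M) * 2 ^ M * 2 ^ (7 * M ^ 2)) := by gcongr
    _ = _ := by simp only [← pow_add]; congr 1; ring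

lemma Ascent.mem_lattice {D : Descent P γ B t} {z₂' z : Vec m} (A : Ascent D z₂' z) :
    A.z₂ ∈ lattice B := by
  rw [A.lift]
  exact add_mem (Submodule.smul_mem _ _ D.oracle.1.1)
    (Submodule.sum_mem _ fun i _ => Submodule.smul_mem _ _ (D.b_mem i))

lemma Level.abs_leading_coeff_le (h : Level M t₀ X B t) (hγ1 : 1 ≤ γ) (hγ : γ ≤ 2 ^ M)
    {D : Descent P γ B t} {z₂' z : Vec m} (A : Ascent D z₂' z)
    (ha : ∀ j, |(A.a j : ℝ)| ≤ 2 ^ (7 * M ^ 2 + 5 * M)) (hz : vnorm A.z₂ ≤ 2 ^ (3 * M)) :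
    |(A.a₁ : ℝ)| ≤ 2 ^ (14 * M ^ 2 + 10 * M) := by
  have hk : k + 1 + 1 ≤ M := le_trans (by omega) h.rank_le
  have h1 : A.a₁ • D.v = A.z₂ - ∑ i, A.a i • D.b i := by rw [A.lift]; abel
  have h2 : vnorm (∑ i, A.a i • D.b i) ≤ ((k + 1 : ℕ) : ℝ) * 2 ^ (7 * M ^ 2 + 9 * M) := by
    refine (vnorm_sum_le _ _).trans ?_
    calc ∑ i, vnorm (A.a i • D.b i) ≤ ∑ _i : Fin (k + 1), (2 : ℝ) ^ (7 * M ^ 2 + 9 * M) := by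
          refine Finset.sum_le_sum fun i _ => ?_
          rw [vnorm_zsmul]
          calc _ ≤ (2 : ℝ) ^ (7 * M ^ 2 + 5 * M) * 2 ^ (4 * M) :=
                mul_le_mul (ha i) (h.vnorm_b_le hγ1 hγ D i) (vnorm_nonneg _) (by positivity)
            _ = _ := by rw [← pow_add]; congr 1; ring
      _ = _ := by simp
  have h3 : vnorm (A.a₁ • D.v) ≤ 2 ^ (7 * M ^ 2 + 10 * M) := by
    rw [h1]
    refine (vnorm_sub_le _ _).trans ((add_le_add hz h2).trans ?_)
    have h4 : ((k + 1 : ℕ) : ℝ) + 1 ≤ 2 ^ M := by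
      have : k + 1 + 1 ≤ 2 ^ M := hk.trans Nat.lt_two_pow_self.le
      exact_mod_cast this
    calc (2 : ℝ) ^ (3 * M) + ((k + 1 : ℕ) : ℝ) * 2 ^ (7 * M ^ 2 + 9 * M)
        ≤ 2 ^ (7 * M ^ 2 + 9 * M) + ((k + 1 : ℕ) : ℝ) * 2 ^ (7 * M ^ 2 + 9 * M) := by
          gcongr
          · norm_num
          · omega
      _ = (((k + 1 : ℕ) : ℝ) + 1) * 2 ^ (7 * M ^ 2 + 9 * M) := by ring
      _ ≤ 2 ^ M * 2 ^ (7 * M ^ 2 + 9 * M) := by gcongr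
      _ = _ := by rw [← pow_add]; congr 1; ring
  refine (h.abs_coeff_le_of_mem D.oracle.1.1 D.oracle.ne_zero h3).trans (le_of_eq ?_)
  congr 1; ring

end Run

/-! ### All vectors of a run -/

/-- The bound on the size of the inputs of the `BDD` solver and of the basis completion. -/
def inputBound (M : ℕ) : ℕ := M * (M * coordBound M) + M * coordBound M + M

/-- The bound on the size of a vector of a run. -/
def totalBound (P : Polynomial ℕ) (M : ℕ) : ℕ :=
  M * coordBound M + P.eval (inputBound M) +
    P.eval (M * coordBound M + M * P.eval (inputBound M))

lemma aeval_le_aeval {A : Type*} [CommSemiring A] [PartialOrder A] [IsOrderedRing A]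
    (Q : Polynomial ℕ) {a b : A} (ha : 0 ≤ a) (hab : a ≤ b) :
    Polynomial.aeval a Q ≤ Polynomial.aeval b Q := by
  induction Q using Polynomial.induction_on' with
  | add p q hp hq => simpa using add_le_add hp hq
  | monomial n c =>
    rw [Polynomial.aeval_monomial, Polynomial.aeval_monomial]
    exact mul_le_mul_of_nonneg_left (pow_le_pow_left₀ ha hab n) (by simp)

lemma eval_le_eval (Q : Polynomial ℕ) {a b : ℕ} (hab : a ≤ b) : Q.eval a ≤ Q.eval b := by
  simpa [Polynomial.coe_aeval_eq_eval] using aeval_le_aeval Q (Nat.zero_le a) hab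

section Total

variable {P : Polynomial ℕ} {γ : ℝ} {M m ℓ k : ℕ} {t₀ t : Vec m} {X : Fin ℓ → Vec m}

lemma vecBits_le_of_dim_le (hm : m ≤ M) {v : Vec m} (hv : ∀ j, ratBits (v j) ≤ coordBound M) :
    vecBits v ≤ M * coordBound M :=
  (vecBits_le hv).trans (Nat.mul_le_mul_right _ hm)

lemma Level.famBits_le {B : Fin k → Vec m} (h : Level M t₀ X B t) (hm : m ≤ M) :
    famBits B ≤ M * (M * coordBound M) :=
  (CVPReduction.famBits_le fun i => vecBits_le_of_dim_le hm (h.ratBits_basis_le i)).trans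
    (Nat.mul_le_mul_right _ (le_trans (by omega) h.rank_le))

lemma ceil_logb_le (hγ1 : 1 ≤ γ) (hγ : γ ≤ 2 ^ M) : ⌈Real.logb 2 γ⌉₊ ≤ M := by
  refine Nat.ceil_le.mpr ((Real.logb_le_iff_le_rpow (by norm_num) (by linarith)).mpr ?_)
  rwa [Real.rpow_natCast]

/-- The outputs and the internal vectors of the three subroutines on one level. -/
lemma Level.subroutines_le {B : Fin (k + 2) → Vec m} (h : Level M t₀ X B t) (hγ1 : 1 ≤ γ)
    (hγ : γ ≤ 2 ^ M) (ht : vecBits t₀ ≤ M) (D : Descent P γ B t) :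
    ∀ w ∈ List.ofFn D.z₁ :: D.wBDD ++ List.ofFn (fun i => List.ofFn (D.bt i)) ++ D.wFB ++ D.wLLL,
      listBits w ≤ totalBound P M := by
  have hm : m ≤ M := (dim_le_vecBits t₀).trans ht
  have hB := h.famBits_le hm
  have htt := vecBits_le_of_dim_le hm (h.ratBits_target_le ht)
  have hv := vecBits_le_of_dim_le hm (h.ratBits_v_le hγ1 hγ D)
  have hlog := ceil_logb_le hγ1 hγ
  have hk : k + 1 ≤ M := le_trans (by omega) h.rank_le
  have hfb : ∀ w ∈ List.ofFn (fun i => List.ofFn (D.bt i)) ++ D.wFB,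
      listBits w ≤ P.eval (inputBound M) := fun w hw =>
    (D.fb_size w hw).trans (eval_le_eval P (by unfold inputBound; omega))
  have hbt : famBits D.bt ≤ M * P.eval (inputBound M) :=
    (CVPReduction.famBits_le fun i => hfb _ (List.mem_append_left _
      ((List.mem_ofFn' _ _).mpr ⟨i, rfl⟩))).trans (Nat.mul_le_mul_right _ hk)
  intro w hw
  rw [List.append_assoc (List.ofFn D.z₁ :: D.wBDD)] at hw
  unfold totalBound
  rcases List.mem_append.mp hw with hw | hw
  · rcases List.mem_append.mp hw with hw | hw
    · have h1 := (D.bdd_size w hw).trans (eval_le_eval P (b := inputBound M)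
        (by unfold inputBound; omega))
      omega
    · have h1 := hfb w hw
      omega
  · have h1 := (D.lll_size w hw).trans (eval_le_eval P (add_le_add hv hbt))
    omega

lemma CVPRun.listBits_otherVectors_le {n : ℕ} {B : Fin n → Vec m} {z : Vec m} (hγ1 : 1 ≤ γ)
    (hγ : γ ≤ 2 ^ M) (r : CVPRun P γ B t z) (h : Level M t₀ X B t) (ht : vecBits t₀ ≤ M) :
    ∀ u ∈ r.otherVectors, listBits u ≤ totalBound P M := by
  have hm : m ≤ M := (dim_le_vecBits t₀).trans ht
  have hvec : ∀ u : Vec m, (∀ j, ratBits (u j) ≤ coordBound M) →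
      listBits (List.ofFn u) ≤ totalBound P M := fun u hu => by
    have h1 : listBits (List.ofFn u) ≤ M * coordBound M := vecBits_le_of_dim_le hm hu
    unfold totalBound; omega
  induction r generalizing ℓ with
  | @base B t z a hn hr =>
    have hM : 1 ≤ M := le_trans (by omega) h.rank_le
    have hM2 : M ≤ M ^ 2 := Nat.le_self_pow two_ne_zero M
    have hz : vnorm z ≤ 2 ^ (3 * M) := vnorm_le_of_sub_le hM
      ((CVPRun.base a hn hr : CVPRun P γ B t z).vnorm_sub_le hγ1 hγ h ht) (h.vnorm_target_le ht)
    intro u hu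
    simp only [CVPRun.otherVectors, List.mem_cons, List.not_mem_nil, or_false] at hu
    rcases hu with rfl | rfl
    · have h1 : ratBits (a : ℚ) ≤ coordBound M := by
        refine (ratBits_intCast_le (h.abs_coeff_le_of_mem (mem_lattice_self B 0)
          (h.basis_indep.ne_zero 0) (hr ▸ hz))).trans ?_
        unfold coordBound; omega
      have h2 : coordBound M ≤ M * coordBound M := Nat.le_mul_of_pos_left _ hM
      have h3 : listBits [(a : ℚ)] = ratBits (a : ℚ) := by simp [listBits]
      rw [h3]; unfold totalBound; omega
    · refine hvec z fun j => h.ratBits_le_of_mem ?_ hz (by omega) j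
      rw [hr]
      exact Submodule.smul_mem _ _ (mem_lattice_self B 0)
  | @step k B t z₂' z D r A ih =>
    obtain ⟨y, h'⟩ := h.step hγ1 hγ D
    have hk : k + 2 ≤ M := le_trans (by omega) h.rank_le
    have hM2 : M ≤ M ^ 2 := Nat.le_self_pow two_ne_zero M
    have hsub := h.subroutines_le hγ1 hγ ht D
    have hdist := r.vnorm_sub_le hγ1 hγ h' ht
    have hz₂' : vnorm z₂' ≤ 2 ^ (3 * M) :=
      vnorm_le_of_sub_le (by omega) hdist (h'.vnorm_target_le ht)
    have hz₂ : vnorm A.z₂ ≤ 2 ^ (3 * M) := by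
      refine vnorm_le_of_sub_le (n := k + 2) hk ?_ (h.vnorm_target_le ht)
      have h1 := A.vnorm_sub_le
      have h2 := h.vnorm_oracle_le hγ1 hγ D.oracle
      push_cast at hdist ⊢
      linarith
    have ha := h.abs_coeff_le hγ1 hγ D A.a (A.coeff ▸ hz₂')
    have ha₁ := h.abs_leading_coeff_le hγ1 hγ A ha hz₂
    have hz₂bits : listBits (List.ofFn A.z₂) ≤ totalBound P M :=
      hvec _ fun j => h.ratBits_le_of_mem A.mem_lattice hz₂ (by omega) j
    intro u hu
    simp only [CVPRun.otherVectors] at hu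
    rcases List.mem_append.mp hu with hu | hu
    · rcases List.mem_append.mp hu with hu | hu
      · exact hsub u hu
      · simp only [List.mem_cons, List.not_mem_nil, or_false] at hu
        rcases hu with rfl | rfl | rfl | rfl | rfl
        · exact hvec _ (h.ratBits_comp_target_le hγ1 hγ ht D)
        · exact hvec _ (h'.ratBits_target_le ht)
        · have h1 : ratBits (A.a₁ : ℚ) ≤ coordBound M := by
            refine (ratBits_intCast_le ha₁).trans ?_
            unfold coordBound; omega
          have h2 : ∀ i, ratBits (A.a i : ℚ) ≤ coordBound M := fun i => by
            refine (ratBits_intCast_le (ha i)).trans ?_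
            unfold coordBound; omega
          have h3 : vecBits (fun i => (A.a i : ℚ)) ≤ (k + 1) * coordBound M := vecBits_le h2
          have h4 : listBits ((A.a₁ : ℚ) :: List.ofFn fun i => (A.a i : ℚ)) =
              ratBits (A.a₁ : ℚ) + vecBits (fun i => (A.a i : ℚ)) := by
            simp [listBits, vecBits]
          have h5 : (k + 2) * coordBound M ≤ M * coordBound M := Nat.mul_le_mul_right _ hk
          rw [h4]; unfold totalBound
          have h6 : (k + 2) * coordBound M = (k + 1) * coordBound M + coordBound M := by ring
          omega
        · exact hz₂bits
        · rcases A.ret with ⟨hz, -⟩ | ⟨hz, -⟩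
          · rw [hz]; exact hsub _ (by simp)
          · rw [hz]; exact hz₂bits
    · exact ih h' u hu

/-- The invariant holds for the input of the whole run. -/
lemma Level.of_integral {n : ℕ} {B : Fin n → Vec m} (hint : ∀ i, B i ∈ intVec m)
    (hB : LinearIndependent ℚ B) (hn : n ≤ M) (hnorm : ∀ i, vnorm (B i) ≤ 2 ^ M) (t : Vec m) :
    Level M t (Fin.elim0 : Fin 0 → Vec m) B t where
  rank_le := by omega
  integral i := i.elim0
  indep := linearIndependent_empty_type
  sum_le := by simp
  basis_indep := hB
  proj u hu := by
    refine ⟨u, ?_, by simp, fun i => i.elim0⟩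
    have hle : lattice B ≤ intVec m := Submodule.span_le.mpr (by rintro _ ⟨i, rfl⟩; exact hint i)
    exact hle hu
  gen := ⟨Set.range B, rfl, by rintro _ ⟨i, rfl⟩; exact hnorm i⟩
  basis_le i := (hnorm i).trans (pow_le_pow_right₀ (by norm_num) (by omega))
  target := ⟨by simp, fun i => i.elim0⟩
  target_le := le_rfl

/-- Composing with `X + 1` absorbs the rounding of a real parameter to an integer. -/
lemma natCast_le_aeval_comp {Q : Polynomial ℕ} {N M : ℕ} {x : ℝ} (hN : N ≤ Q.eval M)
    (hM : (M : ℝ) ≤ x + 1) :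
    (N : ℝ) ≤ Polynomial.aeval x (Q.comp (Polynomial.X + 1)) := by
  rw [Polynomial.aeval_comp]
  have h1 : Polynomial.aeval x (Polynomial.X + 1 : Polynomial ℕ) = x + 1 := by simp
  have h2 : Polynomial.aeval (M : ℝ) Q = ((Q.eval M : ℕ) : ℝ) := by
    simp [Polynomial.aeval_def, Polynomial.eval₂_at_natCast]
  rw [h1]
  exact (Nat.cast_le.mpr hN).trans (h2 ▸ aeval_le_aeval Q (Nat.cast_nonneg M) hM)

end Total

end CVPReduction

open CVPReduction
theorem lemma6 (P : Polynomial ℕ) :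
    ∃ Q : Polynomial ℕ, ∀ (m n : ℕ) (γ : ℝ) (_ : 1 ≤ γ)
      (B₀ : Fin n → Fin m → ℤ) (B : Fin n → Vec m) (_ : B = fun i => ofInt (B₀ i))
      (_ : LinearIndependent ℚ B) (t z : Vec m) (r : CVPRun P γ B t z),
      -- the vectors `v` of the successive levels are the Gram–Schmidt orthogonalization of a
      -- basis `x` of the lattice, and `x` and the vectors `v` are small
      (∃ x : Fin n → Vec m, LinearIndependent ℚ x ∧ lattice x = lattice B ∧
        (∀ i, InnerProductSpace.gramSchmidt ℝ (fun j => toE (x j)) i = toE (r.oracleVectors i)) ∧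
        (∀ i j, (ratBits (x i j) : ℝ) ≤ Polynomial.aeval (sizeParam γ B) Q) ∧
        (∀ i j, (ratBits (r.oracleVectors i j) : ℝ) ≤ Polynomial.aeval (sizeParam γ B) Q)) ∧
      -- so are all coordinates of the vectors `v` and of the bases on all levels
      (∀ u ∈ r.basisVectors, ∀ j,
        (ratBits (u j) : ℝ) ≤ Polynomial.aeval (sizeParam γ B) Q) ∧
      -- and so are all vectors of the run, once the size of the target is counted
      (∀ u ∈ r.allVectors,
        (listBits u : ℝ) ≤ Polynomial.aeval (max (sizeParam γ B) (vecBits t : ℝ)) Q) := by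
  let cP : Polynomial ℕ := 28 * .X ^ 2 + 5 * .X + 3
  let iP : Polynomial ℕ := .X * (.X * cP) + .X * cP + .X
  let tP : Polynomial ℕ := .X * cP + P.comp iP + P.comp (.X * cP + .X * P.comp iP)
  have hcP : ∀ M, cP.eval M = coordBound M := fun M => by simp [cP, coordBound]
  have htP : ∀ M, tP.eval M = totalBound P M := fun M => by
    simp [tP, iP, hcP, totalBound, inputBound]
  have hc : ∀ M, coordBound M ≤ (cP + tP).eval M := fun M => by
    rw [Polynomial.eval_add, hcP]; omega
  have ht : ∀ M, totalBound P M ≤ (cP + tP).eval M := fun M => by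
    rw [Polynomial.eval_add, htP]; omega
  refine ⟨(cP + tP).comp (.X + 1), ?_⟩
  intro m n γ hγ1 B₀ B hB₀ hB t z r
  have hint : ∀ i, B i ∈ intVec m := fun i j => ⟨B₀ i j, by rw [hB₀]; rfl⟩
  -- the integer `M` replaces the real parameter
  have hparam : ∀ M : ℕ, sizeParam γ B ≤ M →
      n ≤ M ∧ γ ≤ 2 ^ M ∧ ∀ i, vnorm (B i) ≤ 2 ^ M := fun M hM => by
    obtain ⟨h1, h2⟩ := max_le_iff.mp hM
    obtain ⟨h2, h3⟩ := max_le_iff.mp h2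
    refine ⟨by exact_mod_cast h1, ?_, fun i => ?_⟩
    · rwa [Real.logb_le_iff_le_rpow (by norm_num) (by linarith), Real.rpow_natCast] at h2
    · have h4 : vnorm (B i) ≤ ⨆ i, vnorm (B i) :=
        le_ciSup (f := fun i => vnorm (B i)) (Set.finite_range _).bddAbove i
      have h5 : 0 < vnorm (B i) := vnorm_pos (hB.ne_zero i)
      rw [Real.logb_le_iff_le_rpow (by norm_num) (h5.trans_le h4), Real.rpow_natCast] at h3
      exact h4.trans h3
  have hpos : 0 ≤ sizeParam γ B := (Nat.cast_nonneg n).trans (le_max_left _ _)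
  constructor
  · obtain ⟨hn, hγ, hnorm⟩ := hparam _ (Nat.le_ceil _)
    have hceil := (Nat.ceil_lt_add_one hpos).le
    have hL := Level.of_integral hint hB hn hnorm t
    have hv := r.oracleVectors_le hγ1 hγ hL
    obtain ⟨x, hx, hlat, hgs, hxle⟩ := r.exists_basis hB
    refine ⟨x, hx, hlat, hgs, fun i j => natCast_le_aeval_comp (le_trans ?_ (hc _)) hceil,
      fun i j => natCast_le_aeval_comp (((hv i).2 j).trans (hc _)) hceil⟩
    generalize ⌈sizeParam γ B⌉₊ = M at *
    have h1 : vnorm (x i) ≤ 2 ^ (5 * M) := by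
      calc vnorm (x i) ≤ ∑ j, vnorm (r.oracleVectors j) := hxle i
        _ ≤ ∑ _j : Fin n, (2 : ℝ) ^ (4 * M) := Finset.sum_le_sum fun j _ => (hv j).1
        _ = n * 2 ^ (4 * M) := by simp
        _ ≤ 2 ^ M * 2 ^ (4 * M) := by
          gcongr
          exact_mod_cast hn.trans Nat.lt_two_pow_self.le
        _ = _ := by rw [← pow_add]; congr 1; ring
    exact hL.ratBits_le_of_mem (hlat ▸ mem_lattice_self x i) h1 (by omega) j
  refine ⟨?_, ?_⟩
  · obtain ⟨hn, hγ, hnorm⟩ := hparam _ (Nat.le_ceil _)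
    have hL := Level.of_integral hint hB hn hnorm t
    exact fun u hu j => natCast_le_aeval_comp
      ((r.ratBits_basisVectors_le hγ1 hγ hL u hu j).trans (hc _)) (Nat.ceil_lt_add_one hpos).le
  · have hmax : 0 ≤ max (sizeParam γ B) (vecBits t : ℝ) := hpos.trans (le_max_left _ _)
    have hceil := (Nat.ceil_lt_add_one hmax).le
    have hle := Nat.le_ceil (max (sizeParam γ B) (vecBits t : ℝ))
    obtain ⟨hn, hγ, hnorm⟩ := hparam _ ((le_max_left _ _).trans hle)
    have htM : vecBits t ≤ ⌈max (sizeParam γ B) (vecBits t : ℝ)⌉₊ := by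
      exact_mod_cast (le_max_right _ _).trans hle
    have hL := Level.of_integral hint hB hn hnorm t
    intro u hu
    refine natCast_le_aeval_comp (le_trans ?_ (ht _)) hceil
    rcases List.mem_append.mp hu with hu | hu
    · obtain ⟨w, hw, rfl⟩ := List.mem_map.mp hu
      have h1 : listBits (List.ofFn w) ≤ _ := vecBits_le_of_dim_le
        ((dim_le_vecBits t).trans htM) (r.ratBits_basisVectors_le hγ1 hγ hL w hw)
      unfold totalBound; omega
    · exact r.listBits_otherVectors_le hγ1 hγ hL htM u hu
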